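/- Let $p$ be an odd prime and $s\ge 1$ an integer such that $p^s\equiv 1\pmod 3$, and let $m=(p^s-1)/3$ or $m=p^s-1$. Write $(x)_0=1$ and $(x)_n=x(x+1)\cdots(x+n-1)$ for $n\ge 1$. Then $$\sum_{k=0}^{m}(6k+1)\frac{(1/3)_k^6}{k!^6}\equiv \frac{(2/3)_{(p^s-1)/3}^3}{(1)_{(p^s-1)/3}^3}\left\{p^s+p^{3s}\sum_{j=1}^{(p^s-1)/3}\left(\frac{1}{(3j-1)^2}-\frac{1}{(3j)^2}\right)\right\}\pmod{p^{s+4}},$$ where, for rational numbers $a,b$, the congruence $a\equiv b\pmod{p^{N}}$ means that $a-b=p^{N}r$ for some rational number $r$ whose reduced denominator is not divisible by $p$. -/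

import Mathlib

/-- The rising factorial `(x)_n = x (x + 1) ⋯ (x + n - 1)` of a rational number, `(x)_0 = 1`. -/
noncomputable def shiftedFactorial (x : ℚ) (n : ℕ) : ℚ := (ascPochhammer ℚ n).eval x

/-- `a ≡ b (mod p ^ N)` for rational numbers: `a - b` lies in `p ^ N ℤ_(p)`, where `ℤ_(p)` is the
ring of the rational numbers whose reduced denominator is not divisible by `p`. -/
def RatModEqPrimePow (p N : ℕ) (a b : ℚ) : Prop :=
  ∃ r : ℚ, ¬ p ∣ r.den ∧ a - b = (p : ℚ) ^ N * r

/-! Write N = p^s = 3n+1, U_k = (1/3)_k/k! and V_k(x) = `pairedRatio x k`, so that V_k(0) = U_k^2. A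
terminating Dougall summation, `sum_wellPoised`, evaluates S(x) = Σ (6k+1) U_k^2 V_k(x) V_k(N) in
closed form. Expanding (U_k^2 - V_k(N))^2 turns the series into 2 S(0) - S(N) + D with D = Σ (6k+1)
U_k^2 (U_k^2 - V_k(N))^2 (`sum_eq_add_sum_diffTerm`). Expanding the closed form of S(N) in powers of
N (`pairedValue_expansion`) gives exactly the right-hand side modulo p^(s+4), so it remains to see
that p^(s+4) divides D (`sum_diffTerm_mem`).

For this the integers in D are replaced by symmetric q-numbers, which makes D the value at q = 1 of
a rational function D(q). At a primitive p^j-th root of unity with j < s, the terms of each block of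
length p^j are proportional to a sequence that is odd under a reflection of the index, so D(q)
vanishes. At primitive p^s-th roots the squared difference supplies [N]^4, and the cofactor is again
a sum odd under k ↦ n - k, so the order of vanishing is at least 5. Since Φ_{p^j}(1) = p, these
zeros contribute p^((s-1)+5) at q = 1. The rest of the denominator is prime to p at 1
(`exists_eq_pow_mul_of_vanishesAt`). -/

/-! ### The terminating very-well-poised summation -/

/-- The product `∏_{i < k} ((3 i + 1)² - x²) / ((3 i + 3)² - x²)`. -/
noncomputable def pairedRatio (x : ℚ) (k : ℕ) : ℚ :=
  ∏ i ∈ Finset.range k, ((3 * (i : ℚ) + 1) ^ 2 - x ^ 2) / ((3 * (i : ℚ) + 3) ^ 2 - x ^ 2)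

/-- The product `∏_{i < n} ((3 i + 2)² - x²) / ((3 i + 3)² - x²)`. -/
noncomputable def pairedValue (x : ℚ) (n : ℕ) : ℚ :=
  ∏ i ∈ Finset.range n, ((3 * (i : ℚ) + 2) ^ 2 - x ^ 2) / ((3 * (i : ℚ) + 3) ^ 2 - x ^ 2)

/-- The product `∏_{i < n} (3 i + 2) / (3 i + 3)`. -/
noncomputable def twoThirdsRatio (n : ℕ) : ℚ :=
  ∏ i ∈ Finset.range n, (3 * (i : ℚ) + 2) / (3 * (i : ℚ) + 3)

lemma pairedRatio_succ (x : ℚ) (k : ℕ) : pairedRatio x (k + 1) =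
    pairedRatio x k * (((3 * (k : ℚ) + 1) ^ 2 - x ^ 2) / ((3 * (k : ℚ) + 3) ^ 2 - x ^ 2)) := by
  rw [pairedRatio, Finset.prod_range_succ, ← pairedRatio]

lemma pairedValue_succ (x : ℚ) (k : ℕ) : pairedValue x (k + 1) =
    pairedValue x k * (((3 * (k : ℚ) + 2) ^ 2 - x ^ 2) / ((3 * (k : ℚ) + 3) ^ 2 - x ^ 2)) := by
  rw [pairedValue, Finset.prod_range_succ, ← pairedValue]

lemma twoThirdsRatio_succ (k : ℕ) : twoThirdsRatio (k + 1) =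
    twoThirdsRatio k * ((3 * (k : ℚ) + 2) / (3 * (k : ℚ) + 3)) := by
  rw [twoThirdsRatio, Finset.prod_range_succ, ← twoThirdsRatio]

lemma pairedRatio_eq_zero {n k : ℕ} (h : n < k) : pairedRatio (3 * (n : ℚ) + 1) k = 0 := by
  apply Finset.prod_eq_zero (Finset.mem_range.2 h)
  simp

lemma three_mul_add_ne_zero (a : ℤ) {c : ℤ} (hc : ¬ (3 : ℤ) ∣ c) : (3 * (a : ℚ) + c) ≠ 0 := by
  intro h
  apply hc
  have : 3 * a + c = 0 := by exact_mod_cast h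
  exact ⟨-a, by linarith⟩

/-- Contiguity relation for `pairedRatio` in the terminating parameter. -/
lemma pairedRatio_contiguous (n k : ℕ) :
    pairedRatio (3 * (n : ℚ) + 1) k * ((3 * n + 2 + 3 * k) * (n + 1) * (3 * n + 1 - 3 * k)
      * (3 * n + 4)) =
    pairedRatio (3 * (n : ℚ) + 4) k * ((3 * n + 2) * (n + 1 - k) * (3 * n + 1)
      * (3 * n + 4 + 3 * k)) := by
  induction k with
  | zero => simp [pairedRatio]
  | succ k ih =>
    have h1 : (3 * (n : ℚ) + 1 - 3 * k) ≠ 0 := by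
      convert three_mul_add_ne_zero (n - k) (c := 1) (by norm_num) using 1; push_cast; ring
    have h2 : (3 * (n : ℚ) + 2 + 3 * k) ≠ 0 := by positivity
    have h5 : (n + 1 : ℚ) ≠ 0 := by positivity
    have h6 : (3 * n + 4 : ℚ) ≠ 0 := by positivity
    have h7 : (3 * (k : ℚ) + 3 * n + 7) ≠ 0 := by positivity
    have h8 : (3 * (k : ℚ) + 3 * n + 4) ≠ 0 := by positivity
    have h9 : (3 * (n : ℚ) - 2 - 3 * k) ≠ 0 := by
      convert three_mul_add_ne_zero (n - k) (c := -2) (by norm_num) using 1; push_cast; ring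
    have e3 : (3 * (k : ℚ) + 3) ^ 2 - (3 * (n : ℚ) + 1) ^ 2 =
      -((3 * (k : ℚ) + 3 * n + 4) * (3 * (n : ℚ) - 2 - 3 * k)) := by ring
    have e4 : (3 * (k : ℚ) + 3) ^ 2 - (3 * (n : ℚ) + 4) ^ 2 =
      -((3 * (k : ℚ) + 3 * n + 7) * (3 * (n : ℚ) + 1 - 3 * k)) := by ring
    have e1 : (3 * (k : ℚ) + 1) ^ 2 - (3 * (n : ℚ) + 1) ^ 2 =
      -((3 * (k : ℚ) + 3 * n + 2) * (3 * (n - k))) := by ring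
    have e2 : (3 * (k : ℚ) + 1) ^ 2 - (3 * (n : ℚ) + 4) ^ 2 =
      -((3 * (k : ℚ) + 3 * n + 5) * (3 * (n + 1 - k))) := by ring
    rw [← eq_div_iff (by simp [h1, h2, h5, h6])] at ih
    rw [pairedRatio_succ, pairedRatio_succ, ih, e1, e2, e3, e4]
    push_cast
    generalize pairedRatio (3 * (n : ℚ) + 4) k = C
    generalize hD : 3 * (n : ℚ) + 1 - 3 * k = D at *
    generalize hE : 3 * (n : ℚ) - 2 - 3 * k = E at *
    generalize hF : 3 * (k : ℚ) + 3 * n + 7 = F at *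
    generalize hG : 3 * (k : ℚ) + 3 * n + 4 = G at *
    generalize hH : 3 * (n : ℚ) + 2 + 3 * k = H at *
    field_simp
    subst hD hE hF hG hH
    ring

/-- The partial sums of the recurrence satisfied by the very-well-poised summand. -/
lemma sum_wellPoised_recurrence (x : ℚ) (hx : ∀ i : ℕ, (3 * (i : ℚ) + 3) ^ 2 - x ^ 2 ≠ 0)
    (n K : ℕ) :
    ∑ k ∈ Finset.range K, (6 * (k : ℚ) + 1) * pairedRatio 0 k * pairedRatio x k *
      (pairedRatio (3 * (n : ℚ) + 4) k - (3 * n + 4) / (3 * n + 1) * ((3 * n + 2) / (3 * n + 3)) *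
        (((3 * (n : ℚ) + 2) ^ 2 - x ^ 2) / ((3 * (n : ℚ) + 3) ^ 2 - x ^ 2)) *
          pairedRatio (3 * (n : ℚ) + 1) k) =
    -(6 * n + 5) * K ^ 2 * (9 * K ^ 2 - x ^ 2) * (3 * K + 3 * n + 4) /
      ((n + 1) ^ 2 * ((3 * (n : ℚ) + 3) ^ 2 - x ^ 2) * (3 * n + 2 + 3 * K)) *
      (pairedRatio 0 K * pairedRatio x K * pairedRatio (3 * (n : ℚ) + 4) K) := by
  induction K with
  | zero => simp
  | succ k ih =>
    have h1 : (3 * (n : ℚ) + 1 - 3 * k) ≠ 0 := by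
      convert three_mul_add_ne_zero (n - k) (c := 1) (by norm_num) using 1; push_cast; ring
    have h2 : (3 * (n : ℚ) + 2 + 3 * k) ≠ 0 := by positivity
    have h2' : (3 * (n : ℚ) + 2 + 3 * (k + 1)) ≠ 0 := by positivity
    have a : (3 * (k : ℚ) + 3 * n + 7) ≠ 0 := by positivity
    have h5 : (n + 1 : ℚ) ≠ 0 := by positivity
    have h6 : (3 * n + 4 : ℚ) ≠ 0 := by positivity
    have h7 : (3 * n + 1 : ℚ) ≠ 0 := by positivity
    have h8 : (k + 1 : ℚ) ≠ 0 := by positivity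
    have hn := hx n
    have hk := hx k
    have hc := pairedRatio_contiguous n k
    rw [← eq_div_iff (by simp [h1, h2, h5, h6])] at hc
    have e4 : ((3 * (k : ℚ) + 3) ^ 2 - (3 * (n : ℚ) + 4) ^ 2) =
      -((3 * (k : ℚ) + 3 * n + 7) * (3 * (n : ℚ) + 1 - 3 * k)) := by ring
    have e3 : (3 * (n : ℚ) + 3) = 3 * (n + 1) := by ring
    have e0 : ((3 * (k : ℚ) + 3) ^ 2 - 0 ^ 2) = 9 * (k + 1) ^ 2 := by ring
    -- Contiguity expresses both parameters through the one at 3n+4. The claim is then a rational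
    -- identity, whose right-hand side is a Wilf–Zeilberger telescoping certificate.
    rw [Finset.sum_range_succ, ih, hc]
    simp only [pairedRatio_succ]
    rw [e4, e0]
    generalize pairedRatio 0 k = A
    generalize pairedRatio x k = B
    generalize pairedRatio (3 * (n : ℚ) + 4) k = C
    have e1 : 9 * ((k + 1 : ℕ) : ℚ) ^ 2 - x ^ 2 = (3 * (k : ℚ) + 3) ^ 2 - x ^ 2 := by
      push_cast; ring
    rw [e1]
    push_cast
    generalize hQ : (3 * (k : ℚ) + 3) ^ 2 - x ^ 2 = Q at *
    generalize hP : (3 * (n : ℚ) + 3) ^ 2 - x ^ 2 = P at *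
    rw [e3]
    generalize hD : 3 * (n : ℚ) + 1 - 3 * k = D at *
    generalize hH : 3 * (n : ℚ) + 2 + 3 * (k + 1) = H at *
    field_simp
    subst hQ hP hD hH
    ring

/-- A special case of Dougall's summation of a terminating very-well-poised `₇F₆`. -/
theorem sum_wellPoised (x : ℚ) (hx : ∀ i : ℕ, (3 * (i : ℚ) + 3) ^ 2 - x ^ 2 ≠ 0) (n : ℕ) :
    ∑ k ∈ Finset.range (n + 1), (6 * (k : ℚ) + 1) * pairedRatio 0 k * pairedRatio x k *
      pairedRatio (3 * (n : ℚ) + 1) k = (3 * n + 1) * twoThirdsRatio n * pairedValue x n := by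
  induction n with
  | zero => simp [pairedRatio, twoThirdsRatio, pairedValue]
  | succ n ih =>
    -- With n+2 terms the sum at parameter n+1 is complete, and the boundary term contains a
    -- terminated product, hence vanishes.
    have h := sum_wellPoised_recurrence x hx n (n + 2)
    have z : pairedRatio (3 * (n : ℚ) + 4) (n + 2) = 0 := by
      convert pairedRatio_eq_zero (n := n + 1) (k := n + 2) (by omega) using 2
      push_cast; ring
    rw [z, mul_zero, mul_zero] at h
    simp only [mul_sub, Finset.sum_sub_distrib, sub_eq_zero] at h
    have e : (3 * ((n + 1 : ℕ) : ℚ) + 1) = 3 * n + 4 := by push_cast; ring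
    rw [e, h, Finset.sum_range_succ, pairedRatio_eq_zero (by omega : n < n + 1), mul_zero, mul_zero,
      add_zero, twoThirdsRatio_succ, pairedValue_succ]
    have h7 : (3 * n + 1 : ℚ) ≠ 0 := by positivity
    trans ((3 * n + 4) / (3 * n + 1) * ((3 * n + 2) / (3 * n + 3)) *
        (((3 * (n : ℚ) + 2) ^ 2 - x ^ 2) / ((3 * (n : ℚ) + 3) ^ 2 - x ^ 2))) *
        ((3 * n + 1) * twoThirdsRatio n * pairedValue x n)
    · rw [← ih, Finset.mul_sum]
      exact Finset.sum_congr rfl fun _ _ => by ring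
    · field_simp

/-! ### p-integral rationals and expansion of the closed form -/

/-- The ring `ℤ_(p)` of the rational numbers whose denominator is not divisible by `p`. -/
def localInt (p : ℕ) [hp : Fact p.Prime] : Subring ℚ where
  carrier := {r | ∃ a b : ℤ, ¬ (p : ℤ) ∣ b ∧ r * b = a}
  zero_mem' := ⟨0, 1, fun h => hp.out.one_lt.ne' (by simpa [Int.natCast_dvd_natCast] using Int.natAbs_dvd_natAbs.2 h), by simp⟩
  one_mem' := ⟨1, 1, fun h => hp.out.one_lt.ne' (by simpa [Int.natCast_dvd_natCast] using Int.natAbs_dvd_natAbs.2 h), by simp⟩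
  add_mem' := by
    rintro x y ⟨a, b, hb, h⟩ ⟨c, d, hd, h'⟩
    refine ⟨a * d + c * b, b * d, (Nat.prime_iff_prime_int.1 hp.out).not_dvd_mul hb hd, ?_⟩
    push_cast
    linear_combination (d : ℚ) * h + b * h'
  mul_mem' := by
    rintro x y ⟨a, b, hb, h⟩ ⟨c, d, hd, h'⟩
    refine ⟨a * c, b * d, (Nat.prime_iff_prime_int.1 hp.out).not_dvd_mul hb hd, ?_⟩
    push_cast
    linear_combination (y * d : ℚ) * h + a * h'
  neg_mem' := by
    rintro x ⟨a, b, hb, h⟩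
    exact ⟨-a, b, hb, by push_cast; linear_combination -h⟩

section localInt
variable {p : ℕ} [hp : Fact p.Prime]

lemma not_dvd_den_of_mem_localInt {r : ℚ} (h : r ∈ localInt p) : ¬ p ∣ r.den := by
  obtain ⟨a, b, hb, h⟩ := h
  intro hd
  have hb0 : (b : ℚ) ≠ 0 := by
    rintro h0
    exact hb (by simp [Int.cast_eq_zero.1 h0])
  apply hb
  have := Rat.den_dvd a b
  rw [Rat.divInt_eq_div, show (a : ℚ) / b = r by rw [← h]; field_simp] at this
  exact (Int.natCast_dvd_natCast.2 hd).trans this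

lemma one_sub_mul_inv_mem_localInt {x : ℚ} (h : x ∈ localInt p) :
    (1 - p * x) ≠ 0 ∧ (1 - p * x)⁻¹ ∈ localInt p := by
  obtain ⟨a, b, hb, h⟩ := h
  have hc : ¬ (p : ℤ) ∣ b - p * a := fun h => hb ((dvd_sub_left (dvd_mul_right _ _)).1 h)
  have hc0 : ((b - p * a : ℤ) : ℚ) ≠ 0 := by
    rintro h0
    exact hc (by simp [Int.cast_eq_zero.1 h0])
  have e : (1 - p * x) * b = ((b - p * a : ℤ) : ℚ) := by push_cast; linear_combination -p * h
  have h0 : (1 - p * x) ≠ 0 := by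
    rintro h0
    rw [h0, zero_mul] at e
    exact hc0 e.symm
  refine ⟨h0, b, _, hc, ?_⟩
  rw [← e]
  field_simp

/-- A positive integer below p^s has p-adic valuation at most s-1. -/
lemma pow_pred_div_mem_localInt {s x : ℕ} (hx : 0 < x) (h : x < p ^ s) :
    (p : ℚ) ^ (s - 1) / x ∈ localInt p := by
  obtain ⟨v, y, hy, rfl⟩ := Nat.exists_eq_pow_mul_and_not_dvd hx.ne' p hp.out.ne_one
  have hv : v < s := by
    rw [← Nat.pow_lt_pow_iff_right hp.out.one_lt]
    refine lt_of_le_of_lt (Nat.le_mul_of_pos_right _ (Nat.pos_of_mul_pos_left hx)) h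
  refine ⟨p ^ (s - 1 - v), y, by exact_mod_cast hy, ?_⟩
  have hy0 : (y : ℚ) ≠ 0 := by
    rintro h0
    exact hy (by simp [Nat.cast_eq_zero.1 h0])
  have hp0 : (p : ℚ) ≠ 0 := by exact_mod_cast hp.out.ne_zero
  obtain ⟨t, rfl⟩ : ∃ t, s = v + t + 1 := ⟨s - 1 - v, by omega⟩
  rw [show v + t + 1 - 1 = v + t by omega, show v + t - v = t by omega]
  push_cast
  field_simp
  ring

/-- The ratio is (2/3)_n/n!. Modulo the p-part of n!, 2/3 may be replaced by a natural number z, and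
n! divides z(z+1)⋯(z+n-1). -/
lemma twoThirdsRatio_mem_localInt (h3 : p ≠ 3) (n : ℕ) : twoThirdsRatio n ∈ localInt p := by
  obtain ⟨M, n', hn', hM⟩ :=
    Nat.exists_eq_pow_mul_and_not_dvd (n.factorial_ne_zero) p hp.out.ne_one
  have hp3 : ¬ p ∣ 3 := fun h => h3 ((Nat.prime_dvd_prime_iff_eq hp.out Nat.prime_three).1 h)
  have hcop : Nat.Coprime 3 (p ^ M) :=
    (((Nat.Prime.coprime_iff_not_dvd hp.out).2 hp3).symm).pow_right M
  obtain ⟨z, hz⟩ : ∃ z : ℕ, 3 * z ≡ 2 [MOD p ^ M] := by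
    obtain ⟨y, hy⟩ := (ZMod.isUnit_iff_coprime 3 (p ^ M)).2 hcop
    have : NeZero (p ^ M) := ⟨pow_ne_zero _ hp.out.ne_zero⟩
    refine ⟨(y⁻¹.val * 2 : ZMod (p ^ M)).val, ?_⟩
    rw [← ZMod.natCast_eq_natCast_iff]
    push_cast
    rw [ZMod.natCast_zmod_val]
    have hy' : (3 : ZMod (p ^ M)) = y := by rw [hy]; norm_cast
    rw [hy', ← mul_assoc, Units.mul_inv, one_mul]
  have hd : p ^ M ∣ ∏ i ∈ Finset.range n, (3 * i + 2) := by
    have h1 : p ^ M ∣ ∏ i ∈ Finset.range n, (3 * (z + i)) := by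
      rw [Finset.prod_mul_distrib, ← Nat.ascFactorial_eq_prod_range]
      refine Dvd.dvd.mul_left (Dvd.dvd.trans ?_ (Nat.factorial_dvd_ascFactorial z n)) _
      rw [hM]; exact dvd_mul_right _ _
    rw [← Nat.modEq_zero_iff_dvd] at h1 ⊢
    refine Nat.ModEq.trans ?_ h1
    rw [← ZMod.natCast_eq_natCast_iff] at hz ⊢
    push_cast at hz ⊢
    exact Finset.prod_congr rfl fun i _ => by rw [mul_add, hz, add_comm]
  obtain ⟨w, hw⟩ := hd
  refine ⟨w, 3 ^ n * n', ?_, ?_⟩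
  · have hpi := Nat.prime_iff_prime_int.1 hp.out
    refine hpi.not_dvd_mul (fun h => hp3 ?_) (by exact_mod_cast hn')
    exact_mod_cast hpi.dvd_of_dvd_pow h
  · have hp0 : (p : ℚ) ≠ 0 := by exact_mod_cast hp.out.ne_zero
    have hw' : ∏ i ∈ Finset.range n, (3 * (i : ℚ) + 2) = p ^ M * w := by exact_mod_cast hw
    have hf : ∏ i ∈ Finset.range n, (3 * (i : ℚ) + 3) = 3 ^ n * (p ^ M * n') := by
      have : (n.factorial : ℚ) = p ^ M * n' := by exact_mod_cast hM
      rw [← this, ← Finset.prod_range_add_one_eq_factorial]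
      push_cast
      rw [← Finset.card_range n, ← Finset.prod_const, Finset.card_range, ← Finset.prod_mul_distrib]
      exact Finset.prod_congr rfl fun i _ => by ring
    have hn0 : (n' : ℚ) ≠ 0 := by
      rintro h0
      exact hn' (by simp [Nat.cast_eq_zero.1 h0])
    rw [twoThirdsRatio, Finset.prod_div_distrib, hw', hf]
    push_cast
    field_simp

/-- The expansion of `pairedValue` at `x = p z` modulo `p ^ 4`. -/
lemma pairedValue_expansion (z : ℚ) (n : ℕ)
    (h2 : ∀ i < n, z / (3 * (i : ℚ) + 2) ∈ localInt p)
    (h3 : ∀ i < n, z / (3 * (i : ℚ) + 3) ∈ localInt p) :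
    ∃ r ∈ localInt p, pairedValue (p * z) n = twoThirdsRatio n ^ 2 * (1 - (p * z) ^ 2 *
      ∑ i ∈ Finset.range n, (1 / (3 * (i : ℚ) + 2) ^ 2 - 1 / (3 * (i : ℚ) + 3) ^ 2) +
        (p : ℚ) ^ 4 * r) := by
  have hpm : (p : ℚ) ∈ localInt p := natCast_mem _ p
  induction n with
  | zero => exact ⟨0, zero_mem _, by simp [pairedValue, twoThirdsRatio]⟩
  | succ n ih =>
    obtain ⟨r, hr, e⟩ := ih (fun i hi => h2 i (by omega)) (fun i hi => h3 i (by omega))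
    have hc := h2 n (by omega)
    have hd := h3 n (by omega)
    have hS : z ^ 2 * ∑ i ∈ Finset.range n,
        (1 / (3 * (i : ℚ) + 2) ^ 2 - 1 / (3 * (i : ℚ) + 3) ^ 2) ∈ localInt p := by
      rw [Finset.mul_sum]
      refine sum_mem fun i hi => ?_
      rw [Finset.mem_range] at hi
      convert sub_mem (pow_mem (h2 i (by omega)) 2) (pow_mem (h3 i (by omega)) 2) using 1
      rw [div_pow, div_pow]
      ring
    set S := ∑ i ∈ Finset.range n, (1 / (3 * (i : ℚ) + 2) ^ 2 - 1 / (3 * (i : ℚ) + 3) ^ 2)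
    obtain ⟨hI0, hI⟩ := one_sub_mul_inv_mem_localInt (mul_mem hpm (pow_mem hd 2))
    have hA : (3 * (n : ℚ) + 2) ≠ 0 := by positivity
    have hB : (3 * (n : ℚ) + 3) ≠ 0 := by positivity
    set c := z / (3 * (n : ℚ) + 2) with hc'
    set d := z / (3 * (n : ℚ) + 3) with hd'
    set I := (1 - p * (p * d ^ 2))⁻¹ with hI'
    have hm : d ^ 2 - c ^ 2 ∈ localInt p := sub_mem (pow_mem hd 2) (pow_mem hc 2)
    -- The new factor is (1 - p²c²)I = 1 + p²(d² - c²)I, and I = 1 + p²d²I. Multiplying the old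
    -- expansion by it and collecting the terms with p^4 gives this remainder.
    refine ⟨r * ((1 - p * (p * c ^ 2)) * I) + d ^ 2 * (d ^ 2 - c ^ 2) * I
      - z ^ 2 * S * ((d ^ 2 - c ^ 2) * I), ?_, ?_⟩
    · exact sub_mem (add_mem (mul_mem hr (mul_mem (sub_mem (one_mem _)
        (mul_mem hpm (mul_mem hpm (pow_mem hc 2)))) hI)) (mul_mem (mul_mem (pow_mem hd 2) hm) hI))
        (mul_mem hS (mul_mem hm hI))
    · have hI1 : (1 - p * (p * d ^ 2)) * I = 1 := mul_inv_cancel₀ hI0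
      have f : ((3 * (n : ℚ) + 2) ^ 2 - (p * z) ^ 2) / ((3 * (n : ℚ) + 3) ^ 2 - (p * z) ^ 2) =
          ((3 * (n : ℚ) + 2) / (3 * (n : ℚ) + 3)) ^ 2 * ((1 - p * (p * c ^ 2)) * I) := by
        have hz2 : z = c * (3 * (n : ℚ) + 2) := by rw [hc']; field_simp
        have hz3 : z = d * (3 * (n : ℚ) + 3) := by rw [hd']; field_simp
        have e2 : (3 * (n : ℚ) + 2) ^ 2 - (p * z) ^ 2 =
          (3 * (n : ℚ) + 2) ^ 2 * (1 - p * (p * c ^ 2)) := by rw [hz2]; ring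
        have e3 : (3 * (n : ℚ) + 3) ^ 2 - (p * z) ^ 2 =
          (3 * (n : ℚ) + 3) ^ 2 * (1 - p * (p * d ^ 2)) := by rw [hz3]; ring
        rw [e2, e3, hI']
        field_simp
      have g : z ^ 2 * (1 / (3 * (n : ℚ) + 2) ^ 2 - 1 / (3 * (n : ℚ) + 3) ^ 2) =
          c ^ 2 - d ^ 2 := by
        rw [hc', hd', div_pow, div_pow]; ring
      rw [pairedValue_succ, f, e, twoThirdsRatio_succ, Finset.sum_range_succ]
      change _ = _ * (1 - (p * z) ^ 2 * (S + _) + _)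
      have g' : (p * z) ^ 2 * (S + (1 / (3 * (n : ℚ) + 2) ^ 2 - 1 / (3 * (n : ℚ) + 3) ^ 2)) =
          p ^ 2 * (z ^ 2 * S + (c ^ 2 - d ^ 2)) := by rw [← g]; ring
      rw [g']
      linear_combination (twoThirdsRatio n * ((3 * (n : ℚ) + 2) / (3 * (n : ℚ) + 3))) ^ 2 *
        (1 - p ^ 2 * (z ^ 2 * S) + p ^ 2 * (d ^ 2 - c ^ 2)) * hI1

end localInt

/-! ### Specialization of fractions -/

open Polynomial

/-- `FracVal φ ε M f y` says that `f = φ A / φ B` with `B ∈ M` and `ε A = y ε B`: the fraction `f`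
specializes to `y` under `ε`. -/
def FracVal {R K F : Type*} [CommRing R] [Field K] [Field F] (φ : R →+* K) (ε : R →+* F)
    (M : Submonoid R) (f : K) (y : F) : Prop :=
  ∃ A, ∃ B ∈ M, f * φ B = φ A ∧ ε A = y * ε B

namespace FracVal
variable {R K F : Type*} [CommRing R] [Field K] [Field F] {φ : R →+* K} {ε : R →+* F}
  {M : Submonoid R} {f g : K} {x y : F}

lemma map (r : R) : FracVal φ ε M (φ r) (ε r) := ⟨r, 1, one_mem _, by simp, by simp⟩

lemma zero : FracVal φ ε M 0 0 := by simpa using map (φ := φ) (ε := ε) (M := M) 0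

lemma one : FracVal φ ε M 1 1 := by simpa using map (φ := φ) (ε := ε) (M := M) 1

lemma add (hf : FracVal φ ε M f x) (hg : FracVal φ ε M g y) : FracVal φ ε M (f + g) (x + y) := by
  obtain ⟨A, B, hB, h1, h2⟩ := hf
  obtain ⟨C, D, hD, h3, h4⟩ := hg
  refine ⟨A * D + C * B, B * D, mul_mem hB hD, ?_, ?_⟩
  · simp only [map_add, map_mul]
    linear_combination φ D * h1 + φ B * h3
  · simp only [map_add, map_mul]
    linear_combination ε D * h2 + ε B * h4

lemma mul (hf : FracVal φ ε M f x) (hg : FracVal φ ε M g y) : FracVal φ ε M (f * g) (x * y) := by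
  obtain ⟨A, B, hB, h1, h2⟩ := hf
  obtain ⟨C, D, hD, h3, h4⟩ := hg
  refine ⟨A * C, B * D, mul_mem hB hD, ?_, ?_⟩
  · simp only [map_mul]
    linear_combination (g * φ D) * h1 + φ A * h3
  · simp only [map_mul]
    linear_combination ε C * h2 + (x * ε B) * h4

lemma neg (hf : FracVal φ ε M f x) : FracVal φ ε M (-f) (-x) := by
  obtain ⟨A, B, hB, h1, h2⟩ := hf
  exact ⟨-A, B, hB, by simp [h1], by simp [h2]⟩

lemma sub (hf : FracVal φ ε M f x) (hg : FracVal φ ε M g y) : FracVal φ ε M (f - g) (x - y) := by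
  simpa only [sub_eq_add_neg] using hf.add hg.neg

lemma pow (hf : FracVal φ ε M f x) (n : ℕ) : FracVal φ ε M (f ^ n) (x ^ n) := by
  induction n with
  | zero => simpa using one
  | succ n ih => simpa only [pow_succ] using ih.mul hf

lemma sum {ι : Type*} {s : Finset ι} {f : ι → K} {x : ι → F}
    (h : ∀ i ∈ s, FracVal φ ε M (f i) (x i)) : FracVal φ ε M (∑ i ∈ s, f i) (∑ i ∈ s, x i) := by
  classical
  induction s using Finset.induction_on with
  | empty => simpa using zero
  | insert a s ha ih =>
    rw [Finset.sum_insert ha, Finset.sum_insert ha]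
    exact (h a (by simp)).add (ih fun i hi => h i (by simp [hi]))

lemma prod {ι : Type*} {s : Finset ι} {f : ι → K} {x : ι → F}
    (h : ∀ i ∈ s, FracVal φ ε M (f i) (x i)) : FracVal φ ε M (∏ i ∈ s, f i) (∏ i ∈ s, x i) := by
  classical
  induction s using Finset.induction_on with
  | empty => simpa using one
  | insert a s ha ih =>
    rw [Finset.prod_insert ha, Finset.prod_insert ha]
    exact (h a (by simp)).mul (ih fun i hi => h i (by simp [hi]))

end FracVal

/-! ### Symmetric q-numbers -/

/-- The symmetric `q`-analogue `(q ^ x - q ^ (-x)) / (q - q⁻¹)` of the integer `x`. -/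
noncomputable def qNum {F : Type*} [Field F] (q : F) (x : ℤ) : F :=
  (q ^ x - q ^ (-x)) / (q - q⁻¹)

section qNum
variable {F : Type*} [Field F] {q : F}

lemma qNum_neg (q : F) (x : ℤ) : qNum q (-x) = -qNum q x := by
  rw [qNum, qNum, neg_neg, ← neg_div, neg_sub]

lemma qNum_zero (q : F) : qNum q 0 = 0 := by simp [qNum]

lemma sub_inv_ne_zero (hq : q ≠ 0) (h2 : q ^ 2 ≠ 1) : q - q⁻¹ ≠ 0 := by
  intro h
  apply h2
  rw [sub_eq_zero] at h
  field_simp at h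
  exact h

lemma qNum_eq_zero_iff (hq : q ≠ 0) (h2 : q ^ 2 ≠ 1) (x : ℤ) :
    qNum q x = 0 ↔ q ^ (2 * x) = 1 := by
  rw [qNum, div_eq_zero_iff, or_iff_left (sub_inv_ne_zero hq h2), sub_eq_zero, zpow_neg, two_mul,
    zpow_add₀ hq]
  have := zpow_ne_zero x hq
  field_simp

/-- Up to a power of q, a q-number is a polynomial with integer coefficients. This form can be
evaluated at q = 1 and factored into cyclotomic polynomials. -/
lemma qNum_succ_mul_pow (hq : q ≠ 0) (h2 : q ^ 2 ≠ 1) (n : ℕ) :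
    qNum q (n + 1) * q ^ n = ∑ i ∈ Finset.range (n + 1), (q ^ 2) ^ i := by
  rw [geom_sum_eq h2, qNum]
  have h := sub_inv_ne_zero hq h2
  have h' : q ^ 2 - 1 ≠ 0 := sub_ne_zero.2 h2
  rw [show ((n : ℤ) + 1) = ((n + 1 : ℕ) : ℤ) by push_cast; rfl, zpow_neg, zpow_natCast]
  rw [div_mul_eq_mul_div, div_eq_div_iff h h']
  field_simp
  ring

lemma qNum_mul (hq : q ≠ 0) (x y : ℤ) (h : q ^ (2 * x) ≠ 1) :
    qNum q (x * y) = qNum q x * qNum (q ^ x) y := by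
  have h' := sub_inv_ne_zero (zpow_ne_zero x hq) (q := q ^ x) (by rwa [← zpow_natCast, ← zpow_mul, mul_comm])
  rw [qNum, qNum, qNum, zpow_neg q x, ← zpow_mul, ← zpow_mul, mul_neg, div_mul_div_comm,
    mul_comm (q - q⁻¹), mul_div_mul_left _ _ h']

/-- The q-form of x² - y²: it makes the product of the two shifts by ±N depend on N only through
[N]². -/
lemma qNum_add_mul_qNum_sub (hq : q ≠ 0) (x y : ℤ) :
    qNum q (x + y) * qNum q (x - y) = qNum q x ^ 2 - qNum q y ^ 2 := by
  simp only [qNum, div_mul_div_comm, div_pow, ← sub_div, ← sq, zpow_neg, zpow_sub₀ hq, zpow_add₀ hq]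
  congr 1
  have := zpow_ne_zero x hq
  have := zpow_ne_zero y hq
  field_simp
  ring

end qNum

/-! ### Reflection symmetry at a root of unity -/

/-- The product `∏_{i < k} b (3 i + 1 + c) / b (3 i + 3 + c)`. -/
noncomputable def ratioProd {F : Type*} [Field F] (b : ℤ → F) (c : ℤ) (k : ℕ) : F :=
  ∏ i ∈ Finset.range k, b (3 * i + 1 + c) * (b (3 * i + 3 + c))⁻¹

/-- The summand of the second difference of the very-well-poised series, formed with a general
analogue `b` of the integers. -/
noncomputable def diffTerm {F : Type*} [Field F] (b : ℤ → F) (N : ℤ) (k : ℕ) : F :=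
  b (6 * k + 1) * ratioProd b 0 k ^ 2 *
    (ratioProd b 0 k ^ 2 - ratioProd b N k * ratioProd b (-N) k) ^ 2

lemma ratioProd_succ {F : Type*} [Field F] (b : ℤ → F) (c : ℤ) (k : ℕ) :
    ratioProd b c (k + 1) = ratioProd b c k * (b (3 * k + 1 + c) * (b (3 * k + 3 + c))⁻¹) := by
  rw [ratioProd, Finset.prod_range_succ, ← ratioProd]

section Reflection
variable {F : Type*} [Field F] {β : ℤ → F} {P n : ℕ}

/-- `β` is an odd function on `ℤ` with period `P` that vanishes exactly on the multiples of `P`. -/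
structure IsOddPeriodic (β : ℤ → F) (P : ℕ) : Prop where
  neg : ∀ x, β (-x) = -β x
  add : ∀ x y, (P : ℤ) ∣ y → β (x + y) = β x
  eq_zero_iff : ∀ x, β x = 0 ↔ (P : ℤ) ∣ x

lemma not_dvd_three_mul_add_three (h3 : Nat.Coprime P 3) {i : ℕ} (hi : i + 1 < P) :
    ¬ (P : ℤ) ∣ 3 * i + 3 := by
  intro h
  have h : P ∣ 3 * (i + 1) := by
    rw [← Int.natCast_dvd_natCast]; push_cast; rwa [mul_add]
  have := Nat.le_of_dvd (by omega) (h3.dvd_of_dvd_mul_left h)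
  omega

lemma not_dvd_three_mul_add_one (h3 : Nat.Coprime P 3) (hn : P ∣ 3 * n + 1) (hnP : n < P) {i : ℕ}
    (hi : i < P) (hin : i ≠ n) : ¬ (P : ℤ) ∣ 3 * i + 1 := by
  intro h
  have h2 : (P : ℤ) ∣ 3 * n + 1 := by exact_mod_cast hn
  have h4 : (P : ℤ) ∣ 3 * ((i : ℤ) - n) := by
    rw [show 3 * ((i : ℤ) - n) = (3 * i + 1) - (3 * n + 1) by ring]
    exact dvd_sub h h2
  have h5 : (P : ℤ) ∣ (i : ℤ) - n :=
    IsCoprime.dvd_of_dvd_mul_left (Nat.isCoprime_iff_coprime.2 h3) h4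
  have := Int.eq_zero_of_abs_lt_dvd h5 (by rw [abs_lt]; constructor <;> omega)
  omega

namespace IsOddPeriodic
variable (hβ : IsOddPeriodic β P)
include hβ

lemma ratioProd_eq_zero (hn : P ∣ 3 * n + 1) {k : ℕ} (hk : n < k) : ratioProd β 0 k = 0 := by
  refine Finset.prod_eq_zero (Finset.mem_range.2 hk) ?_
  rw [(hβ.eq_zero_iff _).2 (by rw [add_zero]; exact_mod_cast hn), zero_mul]

lemma reflect (hn : P ∣ 3 * n + 1) (x y : ℤ) (h : x + y = 3 * n + 1) : β x = -β y := by
  rw [← hβ.neg, ← hβ.add (-y) (3 * n + 1) (by exact_mod_cast hn)]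
  congr 1
  linarith

/-- Since 3n+1 is a period and β is odd, reflection exchanges, up to sign, numerators 3i+1 with
denominators 3j+3 for i + j + 1 = n. Removing a factor from the end of the product is thus the same
as adjoining one at the start. -/
lemma ratioProd_reflect (h3 : Nat.Coprime P 3) (hn : P ∣ 3 * n + 1) (hnP : n < P) {k : ℕ}
    (hk : k ≤ n) : ratioProd β 0 (n - k) = ratioProd β 0 n * ratioProd β 0 k := by
  induction k with
  | zero => simp [ratioProd]
  | succ k ih =>
    obtain ⟨m, rfl⟩ : ∃ m, n = m + 1 + k := ⟨n - 1 - k, by omega⟩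
    have ih := ih (by omega)
    rw [show m + 1 + k - k = m + 1 by omega, ratioProd_succ] at ih
    rw [show m + 1 + k - (k + 1) = m by omega, ratioProd_succ, ← mul_assoc, ← ih]
    have h1 : β (3 * m + 1 + 0) = -β (3 * k + 3 + 0) :=
      hβ.reflect hn _ _ (by push_cast; ring)
    have h2 : β (3 * m + 3 + 0) = -β (3 * k + 1 + 0) :=
      hβ.reflect hn _ _ (by push_cast; ring)
    have h4 : β (3 * k + 3 + 0) ≠ 0 := by
      rw [Ne, hβ.eq_zero_iff, add_zero]
      exact not_dvd_three_mul_add_three h3 (by omega)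
    have h5 : β (3 * k + 1 + 0) ≠ 0 := by
      rw [Ne, hβ.eq_zero_iff, add_zero]
      exact not_dvd_three_mul_add_one h3 hn hnP (by omega) (by omega)
    rw [h1, h2]
    field_simp

lemma ratioProd_reflect_pow (h3 : Nat.Coprime P 3) (hn : P ∣ 3 * n + 1) (hnP : n < P) {k : ℕ}
    (hk : k ≤ n) : ratioProd β 0 (n - k) ^ 6 = ratioProd β 0 k ^ 6 := by
  -- The case k = n gives U_n² = U_0 = 1, so the factor U_n disappears in even powers.
  have h := hβ.ratioProd_reflect h3 hn hnP le_rfl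
  rw [Nat.sub_self, ← sq] at h
  have h1 : ratioProd β 0 n ^ 2 = 1 := by rw [← h]; simp [ratioProd]
  rw [hβ.ratioProd_reflect h3 hn hnP hk]
  linear_combination (ratioProd β 0 k ^ 6) * (ratioProd β 0 n ^ 4 + ratioProd β 0 n ^ 2 + 1) * h1

lemma sum_inv_sq_reflect (h2 : (2 : F) ≠ 0) (hn : P ∣ 3 * n + 1) {k : ℕ} (hk : k ≤ n) :
    ∑ i ∈ Finset.range (n - k), ((β (3 * i + 3) ^ 2)⁻¹ - (β (3 * i + 1) ^ 2)⁻¹) =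
    ∑ i ∈ Finset.range k, ((β (3 * i + 3) ^ 2)⁻¹ - (β (3 * i + 1) ^ 2)⁻¹) := by
  set h : ℕ → F := fun k =>
    ∑ i ∈ Finset.range k, ((β (3 * i + 3) ^ 2)⁻¹ - (β (3 * i + 1) ^ 2)⁻¹) with hh
  have key : ∀ k ≤ n, h (n - k) = h n + h k := by
    intro k hk
    induction k with
    | zero => simp [hh]
    | succ k ih =>
      obtain ⟨m, rfl⟩ : ∃ m, n = m + 1 + k := ⟨n - 1 - k, by omega⟩
      have ih := ih (by omega)
      rw [show m + 1 + k - k = m + 1 by omega] at ih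
      have e1 : h (m + 1) = h m + ((β (3 * m + 3) ^ 2)⁻¹ - (β (3 * m + 1) ^ 2)⁻¹) :=
        Finset.sum_range_succ _ _
      have e2 : h (k + 1) = h k + ((β (3 * k + 3) ^ 2)⁻¹ - (β (3 * k + 1) ^ 2)⁻¹) :=
        Finset.sum_range_succ _ _
      have h1 : β (3 * m + 1) = -β (3 * k + 3) := hβ.reflect hn _ _ (by push_cast; ring)
      have h2 : β (3 * m + 3) = -β (3 * k + 1) := hβ.reflect hn _ _ (by push_cast; ring)
      rw [h1, h2, neg_sq, neg_sq] at e1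
      rw [show m + 1 + k - (k + 1) = m by omega]
      linear_combination ih - e1 - e2
  -- At k = n the relation reads 0 = 2 h(n), so the additive constant vanishes.
  have h0 := key n le_rfl
  rw [Nat.sub_self, ← two_mul, show h 0 = 0 from Finset.sum_range_zero _, eq_comm,
    mul_eq_zero, or_iff_right h2] at h0
  have := key k hk
  rwa [h0, zero_add] at this

/-- Modulo the period, 6(n-k)+1 is -(6k+1), so the sum equals its own negative. -/
lemma sum_mul_eq_zero (h2 : (2 : F) ≠ 0) (hn : P ∣ 3 * n + 1) (g : ℕ → F)
    (hg : ∀ k ≤ n, g (n - k) = g k) :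
    ∑ k ∈ Finset.range (n + 1), β (6 * k + 1) * g k = 0 := by
  have h := Finset.sum_range_reflect (fun k : ℕ => β (6 * k + 1) * g k) (n + 1)
  have e : ∑ k ∈ Finset.range (n + 1), β (6 * ((n + 1 - 1 - k : ℕ) : ℤ) + 1) * g (n + 1 - 1 - k) =
      -∑ k ∈ Finset.range (n + 1), β (6 * k + 1) * g k := by
    rw [← Finset.sum_neg_distrib]
    refine Finset.sum_congr rfl fun k hk => ?_
    have hk : k ≤ n := Nat.lt_succ_iff.1 (Finset.mem_range.1 hk)
    rw [Nat.add_sub_cancel, hg k hk, ← neg_mul, ← hβ.neg,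
      ← hβ.add (-(6 * (k : ℤ) + 1)) (2 * (3 * n + 1)) (Dvd.dvd.mul_left (by exact_mod_cast hn) _)]
    congr 2
    push_cast [hk]
    ring
  rw [e, eq_comm, eq_neg_iff_add_eq_zero, ← two_mul, mul_eq_zero, or_iff_right h2] at h
  exact h

lemma sum_block_eq_zero (h2 : (2 : F) ≠ 0) (h3 : Nat.Coprime P 3) (hn : P ∣ 3 * n + 1)
    (hnP : n < P) {L : ℕ} (hL : n < L) :
    ∑ k ∈ Finset.range L, β (6 * k + 1) * ratioProd β 0 k ^ 6 = 0 := by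
  obtain ⟨r, rfl⟩ : ∃ r, L = n + 1 + r := ⟨L - (n + 1), by omega⟩
  rw [Finset.sum_range_add, hβ.sum_mul_eq_zero h2 hn (fun k => ratioProd β 0 k ^ 6)
    fun k hk => hβ.ratioProd_reflect_pow h3 hn hnP hk, zero_add]
  refine Finset.sum_eq_zero fun k _ => ?_
  rw [hβ.ratioProd_eq_zero hn (by omega)]
  simp

end IsOddPeriodic
end Reflection

/-! ### Rational functions regular at a root of unity -/

section Residue
variable {K : Type*} [Field K] [Algebra ℚ[X] K]

/-- `ResAt ζ f y` says that the rational function `f` is regular at `ζ` with value `y`. -/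
def ResAt (ζ : ℂ) (f : K) (y : ℂ) : Prop :=
  FracVal (algebraMap ℚ[X] K) (aeval ζ : ℚ[X] →ₐ[ℚ] ℂ).toRingHom
    ((nonZeroDivisors ℂ).comap (aeval ζ : ℚ[X] →ₐ[ℚ] ℂ).toRingHom) f y

lemma ResAt.congr {ζ : ℂ} {f : K} {x y : ℂ} (hf : ResAt ζ f y) (h : y = x) : ResAt ζ f x := h ▸ hf

lemma ResAt.zero (ζ : ℂ) : ResAt ζ (0 : K) 0 := FracVal.zero

lemma ResAt.one (ζ : ℂ) : ResAt ζ (1 : K) 1 := FracVal.one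

/-- The indeterminate, as an element of the field of rational functions. -/
noncomputable def indet (K : Type*) [Field K] [Algebra ℚ[X] K] : K := algebraMap ℚ[X] K X

lemma resAt_indet (ζ : ℂ) : ResAt ζ (indet K) ζ :=
  ResAt.congr (FracVal.map X) (aeval_X ζ)

variable [IsFractionRing ℚ[X] K]

lemma indet_ne_zero : indet K ≠ 0 :=
  (map_ne_zero_iff _ (IsFractionRing.injective ℚ[X] K)).2 X_ne_zero

lemma indet_pow_ne_one {m : ℕ} (hm : 0 < m) : indet K ^ m ≠ 1 := by
  rw [indet, ← map_pow, ← map_one (algebraMap ℚ[X] K)]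
  intro h
  have := IsFractionRing.injective ℚ[X] K h
  rw [← sub_eq_zero] at this
  exact (X_pow_sub_C_ne_zero hm (1 : ℚ)) (by simpa using this)

lemma qNum_indet_eq_zero_iff (x : ℤ) : qNum (indet K) x = 0 ↔ x = 0 := by
  rw [qNum_eq_zero_iff indet_ne_zero (indet_pow_ne_one (by norm_num))]
  constructor
  · intro h
    by_contra hx
    refine indet_pow_ne_one (K := K) (m := (2 * x).natAbs) (by omega) ?_
    rcases Int.natAbs_eq (2 * x) with e | e
    · rw [e, zpow_natCast] at h; exact h
    · rw [e, zpow_neg, inv_eq_one, zpow_natCast] at h; exact h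
  · rintro rfl; simp

namespace ResAt
variable {ζ : ℂ} {f g : K} {x y : ℂ}

lemma inv (hf : ResAt ζ f y) (hy : y ≠ 0) : ResAt ζ f⁻¹ y⁻¹ := by
  obtain ⟨A, B, hB, h1, h2⟩ := hf
  have hB' : aeval ζ B ≠ 0 := nonZeroDivisors.ne_zero hB
  have hA : aeval ζ A ≠ 0 := by
    change aeval ζ A = y * aeval ζ B at h2
    rw [h2]; exact mul_ne_zero hy hB'
  refine ⟨B, A, mem_nonZeroDivisors_of_ne_zero hA, ?_, ?_⟩
  · have hA0 : algebraMap ℚ[X] K A ≠ 0 := by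
      rw [Ne, map_eq_zero_iff _ (IsFractionRing.injective ℚ[X] K)]
      rintro rfl
      simp at hA
    have hf : f ≠ 0 := by
      rintro rfl
      rw [zero_mul] at h1
      exact hA0 h1.symm
    rw [← h1, inv_mul_cancel_left₀ hf]
  · rw [h2, inv_mul_cancel_left₀ hy]

lemma zpow (hf : ResAt ζ f y) (hy : y ≠ 0) (n : ℤ) : ResAt ζ (f ^ n) (y ^ n) := by
  rcases Int.eq_nat_or_neg n with ⟨m, rfl | rfl⟩
  · rw [zpow_natCast, zpow_natCast]; exact FracVal.pow hf m
  · rw [zpow_neg, zpow_neg, zpow_natCast, zpow_natCast]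
    exact inv (FracVal.pow hf m) (pow_ne_zero _ hy)

lemma qNum (hζ : ζ ≠ 0) (h2 : ζ ^ 2 ≠ 1) (x : ℤ) :
    ResAt ζ (qNum (indet K) x) (qNum ζ x) := by
  have hi := resAt_indet (K := K) ζ
  have := sub_inv_ne_zero hζ h2
  rw [_root_.qNum, _root_.qNum, div_eq_mul_inv, div_eq_mul_inv]
  exact FracVal.mul (FracVal.sub (hi.zpow hζ x) (hi.zpow hζ (-x)))
    (inv (FracVal.sub hi (hi.inv hζ)) this)

/-- The defining quotient is 0/0 at base 1. The geometric sum has no such defect, and each of its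
terms specializes to 1. -/
lemma qNum_of_one (hf : ResAt ζ f 1) (hf0 : f ≠ 0) (hf2 : f ^ 2 ≠ 1) (x : ℤ) :
    ResAt ζ (_root_.qNum f x) x := by
  have key : ∀ n : ℕ, ResAt ζ (_root_.qNum f n) n := by
    intro n
    rcases n with _ | n
    · rw [Nat.cast_zero, qNum_zero, Nat.cast_zero]
      exact FracVal.zero
    · have h := qNum_succ_mul_pow hf0 hf2 n
      rw [← eq_mul_inv_iff_mul_eq₀ (pow_ne_zero _ hf0)] at h
      push_cast
      rw [h]
      have h1 : ResAt ζ (∑ i ∈ Finset.range (n + 1), (f ^ 2) ^ i)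
          (∑ i ∈ Finset.range (n + 1), ((1 : ℂ) ^ 2) ^ i) :=
        FracVal.sum fun i _ => FracVal.pow (FracVal.pow hf 2) i
      have h2 : ResAt ζ (f ^ n)⁻¹ ((1 : ℂ) ^ n)⁻¹ := inv (FracVal.pow hf n) (by simp)
      exact ResAt.congr (FracVal.mul h1 h2) (by simp)
  rcases Int.eq_nat_or_neg x with ⟨m, rfl | rfl⟩
  · simpa using key m
  · rw [qNum_neg]
    exact ResAt.congr (FracVal.neg (key m)) (by simp)

end ResAt

section Root
variable {P : ℕ} {ζ : ℂ} (hP : 1 < P) (hζ : IsPrimitiveRoot ζ P)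
include hP hζ

/-- The quotient of two `q`-numbers that vanish at `ζ` is regular at `ζ`. -/
lemma exists_resAt_qNum_div {x y : ℤ} (hx : (P : ℤ) ∣ x) (hy : (P : ℤ) ∣ y) (hy0 : y ≠ 0) :
    ∃ c, ResAt ζ (qNum (indet K) x * (qNum (indet K) y)⁻¹) c := by
  obtain ⟨x, rfl⟩ := hx
  obtain ⟨y, rfl⟩ := hy
  have hz : ResAt ζ (indet K ^ (P : ℤ)) 1 := by
    rw [zpow_natCast, ← hζ.pow_eq_one]
    exact FracVal.pow (resAt_indet ζ) P
  have hz0 : indet K ^ (P : ℤ) ≠ 0 := zpow_ne_zero _ indet_ne_zero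
  have hz2 : (indet K ^ (P : ℤ)) ^ 2 ≠ 1 := by
    rw [zpow_natCast, ← pow_mul]
    exact indet_pow_ne_one (by omega)
  have hz2' : indet K ^ (2 * (P : ℤ)) ≠ 1 := by
    rw [mul_comm, zpow_mul]
    exact_mod_cast hz2
  have hP0 : qNum (indet K) P ≠ 0 := by
    rw [Ne, qNum_indet_eq_zero_iff]; omega
  have hy1 : (y : ℂ) ≠ 0 := by
    rintro h
    apply hy0
    rw [Int.cast_eq_zero.1 h, mul_zero]
  refine ⟨x * (y : ℂ)⁻¹, ?_⟩
  rw [qNum_mul indet_ne_zero _ _ hz2', qNum_mul indet_ne_zero _ _ hz2', mul_inv, mul_mul_mul_comm,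
    mul_inv_cancel₀ hP0, one_mul]
  exact FracVal.mul (hz.qNum_of_one hz0 hz2 x) ((hz.qNum_of_one hz0 hz2 y).inv hy1)

variable (hodd : Odd P)
include hodd

lemma IsPrimitiveRoot.sq_ne_one_of_odd : ζ ^ 2 ≠ 1 := by
  intro h
  have := Nat.le_of_dvd (by norm_num) (hζ.dvd_of_pow_eq_one 2 h)
  obtain ⟨k, rfl⟩ := hodd
  omega

lemma isOddPeriodic_qNum : IsOddPeriodic (qNum ζ) P := by
  have hζ0 : ζ ≠ 0 := hζ.ne_zero (by omega)
  refine ⟨qNum_neg ζ, ?_, ?_⟩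
  · rintro x y hy
    have h := (hζ.zpow_eq_one_iff_dvd y).2 hy
    rw [qNum, qNum, neg_add, zpow_add₀ hζ0, zpow_add₀ hζ0, zpow_neg ζ y, h]
    simp
  · intro x
    rw [qNum_eq_zero_iff hζ0 (IsPrimitiveRoot.sq_ne_one_of_odd hP hζ hodd), hζ.zpow_eq_one_iff_dvd]
    refine ⟨fun h => ?_, fun h => Dvd.dvd.mul_left h _⟩
    refine IsCoprime.dvd_of_dvd_mul_left ?_ h
    exact Nat.isCoprime_iff_coprime.2 (Nat.coprime_two_right.2 hodd)

end Root
end Residue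

/-! ### Vanishing on blocks whose length is the order of the root of unity -/

section Blocks
variable {K : Type*} [Field K] [Algebra ℚ[X] K] [IsFractionRing ℚ[X] K]
variable {P : ℕ} {ζ : ℂ} (hP : 1 < P) (hζ : IsPrimitiveRoot ζ P) (hodd : Odd P)
  (h3 : Nat.Coprime P 3) {n : ℕ} (hn : P ∣ 3 * n + 1) (hnP : n < P)
include hP hζ hodd h3

/-- Up to a regular factor, `ratioProd` at `a P + r` specializes to `ratioProd` at `r`. -/
lemma resAt_ratioProd_shift {c : ℤ} (hc : (P : ℤ) ∣ c) (a : ℕ) {r : ℕ} (hr : r < P) :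
    ResAt ζ (∏ i ∈ Finset.range r, qNum (indet K) (3 * (a * P + i : ℕ) + 1 + c) *
      (qNum (indet K) (3 * (a * P + i : ℕ) + 3 + c))⁻¹) (ratioProd (qNum ζ) 0 r) := by
  have hβ := isOddPeriodic_qNum hP hζ hodd
  have hζ0 : ζ ≠ 0 := hζ.ne_zero (by omega)
  have hζ2 := IsPrimitiveRoot.sq_ne_one_of_odd hP hζ hodd
  refine FracVal.prod fun i hi => ?_
  rw [Finset.mem_range] at hi
  have hd : (P : ℤ) ∣ 3 * (a * P) + c := dvd_add ⟨3 * a, by ring⟩ hc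
  have e1 : qNum ζ (3 * (a * P + i : ℕ) + 1 + c) = qNum ζ (3 * i + 1 + 0) := by
    rw [← hβ.add (3 * i + 1 + 0) _ hd]; congr 1; push_cast; ring
  have e3 : qNum ζ (3 * (a * P + i : ℕ) + 3 + c) = qNum ζ (3 * i + 3 + 0) := by
    rw [← hβ.add (3 * i + 3 + 0) _ hd]; congr 1; push_cast; ring
  rw [← e1, ← e3]
  refine FracVal.mul (ResAt.qNum hζ0 hζ2 _) (ResAt.inv (ResAt.qNum hζ0 hζ2 _) ?_)
  rw [e3, Ne, hβ.eq_zero_iff, add_zero]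
  exact not_dvd_three_mul_add_three h3 (by omega)

include hn hnP

/-- Each full block contains one vanishing numerator, at i = n, and one vanishing denominator, at i
= P - 1. Their quotient is regular, so zero and pole cancel. -/
lemma exists_resAt_ratioProd {c : ℤ} (hc : (P : ℤ) ∣ c) (hc0 : ∀ i : ℕ, 3 * (i : ℤ) + 3 + c ≠ 0)
    (a : ℕ) : ∃ y, ResAt ζ (ratioProd (qNum (indet K)) c (a * P)) y := by
  have hβ := isOddPeriodic_qNum hP hζ hodd
  have hζ0 : ζ ≠ 0 := hζ.ne_zero (by omega)
  have hζ2 := IsPrimitiveRoot.sq_ne_one_of_odd hP hζ hodd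
  induction a with
  | zero => exact ⟨1, by simpa [ratioProd] using ResAt.one ζ⟩
  | succ a ih =>
    obtain ⟨y, hy⟩ := ih
    have hd : (P : ℤ) ∣ 3 * (a * P) + c := dvd_add ⟨3 * a, by ring⟩ hc
    rw [ratioProd, add_mul, one_mul, Finset.prod_range_add, ← ratioProd, Finset.prod_mul_distrib]
    have hN : n ∈ Finset.range P := Finset.mem_range.2 hnP
    have hD : P - 1 ∈ Finset.range P := Finset.mem_range.2 (by omega)
    rw [← Finset.mul_prod_erase _ _ hN, ← Finset.mul_prod_erase _ _ hD, mul_mul_mul_comm]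
    have hP1 : ((P - 1 : ℕ) : ℤ) = P - 1 := by push_cast [hP.le]; ring
    obtain ⟨z, hz⟩ := exists_resAt_qNum_div (K := K) hP hζ
      (x := 3 * (a * P + n : ℕ) + 1 + c) (y := 3 * (a * P + (P - 1) : ℕ) + 3 + c)
      (by
        have := dvd_add hd (show (P : ℤ) ∣ 3 * n + 1 by exact_mod_cast hn)
        rwa [show 3 * ((a * P + n : ℕ) : ℤ) + 1 + c = 3 * (a * P) + c + (3 * n + 1) by
          push_cast; ring])
      (by
        have := dvd_add hd (show (P : ℤ) ∣ 3 * P from Dvd.intro_left _ rfl)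
        rwa [show 3 * ((a * P + (P - 1) : ℕ) : ℤ) + 3 + c = 3 * (a * P) + c + 3 * P by
          rw [Nat.cast_add, hP1]; push_cast; ring])
      (by exact_mod_cast hc0 _)
    have h1 : ResAt ζ (∏ i ∈ (Finset.range P).erase n,
        qNum (indet K) (3 * (a * P + i : ℕ) + 1 + c)) _ :=
      FracVal.prod fun i _ => ResAt.qNum hζ0 hζ2 _
    have h2 : ResAt ζ (∏ i ∈ (Finset.range P).erase (P - 1),
        (qNum (indet K) (3 * (a * P + i : ℕ) + 3 + c))⁻¹) _ :=
      FracVal.prod fun i hi => ResAt.inv (ResAt.qNum hζ0 hζ2 _) (by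
        have e3 : qNum ζ (3 * (a * P + i : ℕ) + 3 + c) = qNum ζ (3 * i + 3) := by
          rw [← hβ.add (3 * i + 3) _ hd]; congr 1; push_cast; ring
        rw [Finset.mem_erase, Finset.mem_range] at hi
        rw [e3, Ne, hβ.eq_zero_iff]
        exact not_dvd_three_mul_add_three h3 (by omega))
    exact ⟨_, FracVal.mul hy (FracVal.mul hz (FracVal.mul h1 h2))⟩

/-- Shifts by multiples of P are invisible at ζ, so all three products at aP + r become a constant
depending only on a times the same U_r. Apart from the linear factor, the term is homogeneous of
degree six in these products. -/
lemma exists_resAt_diffTerm {N : ℤ} (hN : (P : ℤ) ∣ N) (hN3 : ¬ (3 : ℤ) ∣ N) (a : ℕ) :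
    ∃ C, ∀ r < P, ResAt ζ (diffTerm (qNum (indet K)) N (a * P + r))
      (C * (qNum ζ (6 * r + 1) * ratioProd (qNum ζ) 0 r ^ 6)) := by
  have hβ := isOddPeriodic_qNum hP hζ hodd
  have hζ0 : ζ ≠ 0 := hζ.ne_zero (by omega)
  have hζ2 := IsPrimitiveRoot.sq_ne_one_of_odd hP hζ hodd
  obtain ⟨y, hy⟩ := exists_resAt_ratioProd (K := K) hP hζ hodd h3 hn hnP (c := 0) (by simp)
    (by intro i; omega) a
  obtain ⟨z, hz⟩ := exists_resAt_ratioProd (K := K) hP hζ hodd h3 hn hnP (c := N) hN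
    (by intro i h; exact hN3 (by omega)) a
  obtain ⟨w, hw⟩ := exists_resAt_ratioProd (K := K) hP hζ hodd h3 hn hnP (c := -N) (by simpa)
    (by intro i h; exact hN3 (by omega)) a
  refine ⟨y ^ 2 * (y ^ 2 - z * w) ^ 2, fun r hr => ?_⟩
  have key : ∀ {c : ℤ} {y : ℂ}, (P : ℤ) ∣ c → ResAt ζ (ratioProd (qNum (indet K)) c (a * P)) y →
      ResAt ζ (ratioProd (qNum (indet K)) c (a * P + r)) (y * ratioProd (qNum ζ) 0 r) := by
    intro c y hc h
    rw [ratioProd, Finset.prod_range_add, ← ratioProd]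
    exact FracVal.mul h (resAt_ratioProd_shift hP hζ hodd h3 hc a hr)
  have ky := key (by simp) hy
  have e : qNum ζ (6 * (a * P + r : ℕ) + 1) = qNum ζ (6 * r + 1) := by
    rw [← hβ.add (6 * r + 1) (6 * a * P) (Dvd.intro_left _ rfl)]; congr 1; push_cast; ring
  refine ResAt.congr (FracVal.mul (FracVal.mul (ResAt.qNum hζ0 hζ2 _) (FracVal.pow ky 2))
    (FracVal.pow (FracVal.sub (FracVal.pow ky 2)
      (FracVal.mul (key hN hz) (key (by simpa) hw))) 2)) ?_
  rw [e]
  ring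

/-- The sum of `diffTerm` over full blocks of length `P`, followed by a sufficiently long partial
block, vanishes at `ζ`. -/
lemma resAt_sum_diffTerm {N : ℤ} (hN : (P : ℤ) ∣ N) (hN3 : ¬ (3 : ℤ) ∣ N) (a : ℕ) {L : ℕ}
    (hL : n < L) (hLP : L ≤ P) :
    ResAt ζ (∑ k ∈ Finset.range (a * P + L), diffTerm (qNum (indet K)) N k) 0 := by
  have hβ := isOddPeriodic_qNum hP hζ hodd
  have block : ∀ a L : ℕ, n < L → L ≤ P →
      ResAt ζ (∑ r ∈ Finset.range L, diffTerm (qNum (indet K)) N (a * P + r)) 0 := by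
    intro a L hL hLP
    obtain ⟨C, hC⟩ := exists_resAt_diffTerm (K := K) hP hζ hodd h3 hn hnP hN hN3 a
    refine ResAt.congr (FracVal.sum fun r hr => hC r (by
      rw [Finset.mem_range] at hr; omega)) ?_
    rw [← Finset.mul_sum, hβ.sum_block_eq_zero two_ne_zero h3 hn hnP hL, mul_zero]
  have full : ResAt ζ (∑ k ∈ Finset.range (a * P), diffTerm (qNum (indet K)) N k) 0 := by
    clear hL hLP
    induction a with
    | zero => simpa using ResAt.zero ζ
    | succ a ih =>
      rw [add_mul, one_mul, Finset.sum_range_add]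
      exact ResAt.congr (FracVal.add ih (block a P hnP le_rfl)) (add_zero 0)
  rw [Finset.sum_range_add]
  exact ResAt.congr (FracVal.add full (block a L hL hLP)) (add_zero 0)

end Blocks

lemma coprime_three_mul_add_one (n : ℕ) : Nat.Coprime (3 * n + 1) 3 := by
  simp

/-! ### Fifth-order vanishing at the top root of unity -/

section Order
variable {K : Type*} [Field K] [Algebra ℚ[X] K] [IsFractionRing ℚ[X] K]
variable {n : ℕ} {ζ : ℂ} (hn : 0 < n) (hζ : IsPrimitiveRoot ζ (3 * n + 1)) (hodd : Odd (3 * n + 1))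
include hn hζ hodd

/-- Pairing the shifts by ±N gives factors (x² - ε)/(y² - ε) with ε = [N]², so the product differs
from U_k² at first order in ε, with a sum of inverse squares as coefficient. -/
lemma exists_ratioProd_mul_ratioProd {k : ℕ} (hk : k ≤ n) :
    ∃ g, ratioProd (qNum (indet K)) (3 * n + 1) k * ratioProd (qNum (indet K)) (-(3 * n + 1)) k =
      ratioProd (qNum (indet K)) 0 k ^ 2 * (1 - qNum (indet K) (3 * n + 1) ^ 2 * g) ∧
      ResAt ζ g (-∑ i ∈ Finset.range k,
        ((qNum ζ (3 * i + 3) ^ 2)⁻¹ - (qNum ζ (3 * i + 1) ^ 2)⁻¹)) := by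
  have hP : 1 < 3 * n + 1 := by omega
  have hβ := isOddPeriodic_qNum hP hζ hodd
  have hζ0 : ζ ≠ 0 := hζ.ne_zero (by omega)
  have hζ2 := IsPrimitiveRoot.sq_ne_one_of_odd hP hζ hodd
  induction k with
  | zero => exact ⟨0, by simp [ratioProd], by simpa using ResAt.zero ζ⟩
  | succ k ih =>
    obtain ⟨g, hg, hr⟩ := ih (by omega)
    have hx : qNum ζ (3 * k + 1) ≠ 0 := by
      rw [Ne, hβ.eq_zero_iff]
      exact not_dvd_three_mul_add_one (coprime_three_mul_add_one n) dvd_rfl (by omega) (by omega)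
        (by omega)
    have hy : qNum ζ (3 * k + 3) ≠ 0 := by
      rw [Ne, hβ.eq_zero_iff]
      exact not_dvd_three_mul_add_three (coprime_three_mul_add_one n) (by omega)
    have rα := ResAt.inv (FracVal.pow (ResAt.qNum (K := K) hζ0 hζ2 (3 * k + 1)) 2)
      (pow_ne_zero 2 hx)
    have rβ := ResAt.inv (FracVal.pow (ResAt.qNum (K := K) hζ0 hζ2 (3 * k + 3)) 2)
      (pow_ne_zero 2 hy)
    have rε : ResAt ζ (qNum (indet K) (3 * n + 1) ^ 2) 0 := by
      refine ResAt.congr (FracVal.pow (ResAt.qNum (K := K) hζ0 hζ2 (3 * n + 1)) 2) ?_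
      rw [(hβ.eq_zero_iff _).2 (by push_cast; exact dvd_rfl)]; simp
    have fx : qNum (indet K) (3 * k + 1) ≠ 0 := by
      rw [Ne, qNum_indet_eq_zero_iff]; omega
    have fy : qNum (indet K) (3 * k + 3) ≠ 0 := by
      rw [Ne, qNum_indet_eq_zero_iff]; omega
    have fp : qNum (indet K) (3 * k + 3 + (3 * n + 1)) ≠ 0 := by
      rw [Ne, qNum_indet_eq_zero_iff]; omega
    have fm : qNum (indet K) (3 * k + 3 - (3 * n + 1)) ≠ 0 := by
      rw [Ne, qNum_indet_eq_zero_iff]; omega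
    have e1 := qNum_add_mul_qNum_sub (indet_ne_zero (K := K)) (3 * k + 1) (3 * n + 1)
    have e3 := qNum_add_mul_qNum_sub (indet_ne_zero (K := K)) (3 * k + 3) (3 * n + 1)
    have f3 := mul_ne_zero fp fm
    set ε := qNum (indet K) (3 * n + 1) ^ 2
    set x := qNum (indet K) (3 * k + 1)
    set y := qNum (indet K) (3 * k + 3)
    have rI : ResAt ζ (1 - ε * (y ^ 2)⁻¹)⁻¹ 1 := by
      have h := FracVal.sub (ResAt.one (K := K) ζ) (FracVal.mul rε rβ)
      refine ResAt.congr (ResAt.inv h ?_) ?_ <;> simp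
    -- The ratio (1 - ε/x²)/(1 - ε/y²) equals 1 + ε(y⁻² - x⁻²)/(1 - ε/y²). Multiplying by 1 - εg and
    -- dividing out ε gives the new coefficient.
    refine ⟨g - (1 - ε * g) * ((y ^ 2)⁻¹ - (x ^ 2)⁻¹) * (1 - ε * (y ^ 2)⁻¹)⁻¹, ?_, ?_⟩
    · have f4 : y ^ 2 - ε ≠ 0 := e3 ▸ f3
      have f5 : 1 - ε * (y ^ 2)⁻¹ = (y ^ 2 - ε) * (y ^ 2)⁻¹ := by field_simp
      rw [ratioProd_succ, ratioProd_succ, ratioProd_succ, mul_mul_mul_comm, hg,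
        mul_mul_mul_comm (qNum (indet K) _), ← mul_inv, ← sub_eq_add_neg, ← sub_eq_add_neg, e1, e3,
        f5, add_zero, add_zero]
      change _ = (_ * (x * y⁻¹)) ^ 2 * _
      field_simp
      ring
    · refine ResAt.congr (FracVal.sub hr (FracVal.mul (FracVal.mul (FracVal.sub (ResAt.one ζ)
        (FracVal.mul rε hr)) (FracVal.sub rβ rα)) rI)) ?_
      rw [Finset.sum_range_succ]
      ring

/-- For k ≤ n the squared difference is divisible by [N]^4. For k > n the paired product is zero
while U_k itself contains [N], so the term carries [N]^6 and its cofactor vanishes at ζ. -/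
lemma exists_diffTerm_eq_pow_mul {k : ℕ} (hk : k < 3 * n + 1) :
    ∃ G, diffTerm (qNum (indet K)) (3 * n + 1) k = qNum (indet K) (3 * n + 1) ^ 4 * G ∧
      ResAt ζ G (qNum ζ (6 * k + 1) * (ratioProd (qNum ζ) 0 k ^ 6 * (∑ i ∈ Finset.range k,
        ((qNum ζ (3 * i + 3) ^ 2)⁻¹ - (qNum ζ (3 * i + 1) ^ 2)⁻¹)) ^ 2)) := by
  have hP : 1 < 3 * n + 1 := by omega
  have h3 := coprime_three_mul_add_one n
  have hβ := isOddPeriodic_qNum hP hζ hodd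
  have hζ0 : ζ ≠ 0 := hζ.ne_zero (by omega)
  have hζ2 := IsPrimitiveRoot.sq_ne_one_of_odd hP hζ hodd
  rcases le_or_gt k n with hkn | hkn
  · obtain ⟨g, hg, hr⟩ := exists_ratioProd_mul_ratioProd (K := K) hn hζ hodd hkn
    refine ⟨qNum (indet K) (6 * k + 1) * (ratioProd (qNum (indet K)) 0 k ^ 6 * g ^ 2), ?_, ?_⟩
    · rw [diffTerm, hg]; ring
    · have hU : ResAt ζ (ratioProd (qNum (indet K)) 0 k) (ratioProd (qNum ζ) 0 k) := by
        simpa [ratioProd] using resAt_ratioProd_shift (K := K) hP hζ hodd h3 (dvd_zero _) 0 hk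
      refine ResAt.congr (FracVal.mul (ResAt.qNum hζ0 hζ2 _)
        (FracVal.mul (FracVal.pow hU 6) (FracVal.pow hr 2))) ?_
      rw [neg_sq]
  · have hz : ratioProd (qNum (indet K)) (-(3 * n + 1)) k = 0 := by
      refine Finset.prod_eq_zero (Finset.mem_range.2 hkn) ?_
      rw [add_neg_cancel, qNum_zero, zero_mul]
    obtain ⟨V, v, hV, hv⟩ : ∃ V v, ratioProd (qNum (indet K)) 0 k =
        qNum (indet K) (3 * n + 1) * V ∧ ResAt ζ V v := by
      have h1 : ResAt ζ (∏ i ∈ (Finset.range k).erase n, qNum (indet K) (3 * i + 1 + 0)) _ :=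
        FracVal.prod fun i _ => ResAt.qNum hζ0 hζ2 _
      have h2 : ResAt ζ (∏ i ∈ Finset.range k, (qNum (indet K) (3 * i + 3 + 0))⁻¹) _ :=
        FracVal.prod fun i hi => ResAt.inv (ResAt.qNum hζ0 hζ2 _) (by
          rw [Finset.mem_range] at hi
          rw [Ne, hβ.eq_zero_iff, add_zero]
          exact not_dvd_three_mul_add_three h3 (by omega))
      refine ⟨_, _, ?_, FracVal.mul h1 h2⟩
      rw [ratioProd, Finset.prod_mul_distrib, ← Finset.mul_prod_erase _ _ (Finset.mem_range.2 hkn),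
        add_zero, mul_assoc]
    refine ⟨qNum (indet K) (6 * k + 1) * (V ^ 6 * qNum (indet K) (3 * n + 1) ^ 2), ?_, ?_⟩
    · rw [diffTerm, hz, hV]; ring
    · refine ResAt.congr (FracVal.mul (ResAt.qNum hζ0 hζ2 _)
        (FracVal.mul (FracVal.pow hv 6) (FracVal.pow (ResAt.qNum hζ0 hζ2 _) 2))) ?_
      rw [(hβ.eq_zero_iff (3 * n + 1)).2 (by push_cast; exact dvd_rfl),
        hβ.ratioProd_eq_zero dvd_rfl hkn]
      simp

/-- The sum of `diffTerm` vanishes to order five at the primitive `(3 n + 1)`-th roots of unity. -/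
lemma exists_sum_diffTerm_eq_pow_mul {m : ℕ} (hnm : n ≤ m) (hm : m < 3 * n + 1) :
    ∃ G, ∑ k ∈ Finset.range (m + 1), diffTerm (qNum (indet K)) (3 * n + 1) k =
      qNum (indet K) (3 * n + 1) ^ 4 * G ∧ ResAt ζ G 0 := by
  have hP : 1 < 3 * n + 1 := by omega
  have h3 := coprime_three_mul_add_one n
  have hβ := isOddPeriodic_qNum hP hζ hodd
  have H : ∀ k, ∃ G, k < 3 * n + 1 → diffTerm (qNum (indet K)) (3 * n + 1) k =
      qNum (indet K) (3 * n + 1) ^ 4 * G ∧ ResAt ζ G (qNum ζ (6 * k + 1) *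
        (ratioProd (qNum ζ) 0 k ^ 6 * (∑ i ∈ Finset.range k,
        ((qNum ζ (3 * i + 3) ^ 2)⁻¹ - (qNum ζ (3 * i + 1) ^ 2)⁻¹)) ^ 2)) := by
    intro k
    by_cases hk : k < 3 * n + 1
    · obtain ⟨G, hG⟩ := exists_diffTerm_eq_pow_mul (K := K) hn hζ hodd hk
      exact ⟨G, fun _ => hG⟩
    · exact ⟨0, fun h => absurd h hk⟩
  choose G hG using H
  have hlt : ∀ k ∈ Finset.range (m + 1), k < 3 * n + 1 := fun k hk => by
    rw [Finset.mem_range] at hk; omega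
  refine ⟨∑ k ∈ Finset.range (m + 1), G k, ?_, ?_⟩
  · rw [Finset.mul_sum]
    exact Finset.sum_congr rfl fun k hk => (hG k (hlt k hk)).1
  · refine ResAt.congr (FracVal.sum fun k hk => (hG k (hlt k hk)).2) ?_
    obtain ⟨r, rfl⟩ := Nat.exists_eq_add_of_le hnm
    rw [show n + r + 1 = n + 1 + r by omega, Finset.sum_range_add]
    -- The cofactor is symmetric under k ↦ n - k: both U_k^6 and the inverse-square sums are
    -- invariant. The terms with k > n vanish separately.
    rw [hβ.sum_mul_eq_zero two_ne_zero (n := n) dvd_rfl (fun k => ratioProd (qNum ζ) 0 k ^ 6 *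
      (∑ i ∈ Finset.range k, ((qNum ζ (3 * i + 3) ^ 2)⁻¹ - (qNum ζ (3 * i + 1) ^ 2)⁻¹)) ^ 2)
      fun k hk => by
        rw [hβ.ratioProd_reflect_pow h3 dvd_rfl (by omega) hk,
          hβ.sum_inv_sq_reflect two_ne_zero dvd_rfl hk], zero_add]
    refine Finset.sum_eq_zero fun k _ => ?_
    rw [hβ.ratioProd_eq_zero (n := n) dvd_rfl (by omega)]
    simp

end Order

/-! ### From cyclotomic vanishing to powers of p -/

section Integral
variable {p : ℕ} [hp : Fact p.Prime]

/-- The integer polynomials `B` that become prime to `p` at `1` after division by powers of the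
cyclotomic polynomials of order `p, …, p ^ s`. -/
def cyclotomicDenominators (p s : ℕ) [hp : Fact p.Prime] : Submonoid ℤ[X] where
  carrier := {B | ∃ (c : ℕ → ℕ) (B' : ℤ[X]), ¬ (p : ℤ) ∣ B'.eval 1 ∧
    B = (∏ j ∈ Finset.range s, cyclotomic (p ^ (j + 1)) ℤ ^ c j) * B'}
  one_mem' := ⟨0, 1, by
    simpa using (Nat.prime_iff_prime_int.1 hp.out).not_dvd_one, by simp⟩
  mul_mem' := by
    rintro _ _ ⟨c, B, hB, rfl⟩ ⟨d, C, hC, rfl⟩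
    refine ⟨c + d, B * C, ?_, ?_⟩
    · rw [eval_mul]
      exact (Nat.prime_iff_prime_int.1 hp.out).not_dvd_mul hB hC
    · simp only [Pi.add_apply, pow_add, Finset.prod_mul_distrib]
      ring

lemma mem_cyclotomicDenominators_of_not_dvd {s : ℕ} {B : ℤ[X]} (hB : ¬ (p : ℤ) ∣ B.eval 1) :
    B ∈ cyclotomicDenominators p s := ⟨0, B, hB, by simp⟩

lemma cyclotomic_mem_cyclotomicDenominators {s j : ℕ} (hj : j < s) :
    cyclotomic (p ^ (j + 1)) ℤ ∈ cyclotomicDenominators p s := by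
  refine ⟨Pi.single j 1, 1, by simpa using (Nat.prime_iff_prime_int.1 hp.out).not_dvd_one, ?_⟩
  rw [mul_one, Finset.prod_eq_single j]
  · simp
  · intro b _ hb
    simp [hb]
  · intro h
    exact absurd (Finset.mem_range.2 hj) h

lemma prod_cyclotomic_mul_X_sub_one (v : ℕ) :
    (∏ j ∈ Finset.range v, cyclotomic (p ^ (j + 1)) ℤ) * (X - 1) = X ^ p ^ v - 1 := by
  induction v with
  | zero => simp
  | succ v ih =>
    rw [Finset.prod_range_succ, mul_right_comm, ih, mul_comm,
      cyclotomic_prime_pow_mul_X_pow_sub_one]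

/-- For n = p^v y with p ∤ y, the sum splits into the factors Φ_{p^j}(X²) with j ≤ v and a factor
with value y at 1. For odd p, Φ_{p^j}(X²) = Φ_{p^j} Φ_{2p^j}, and Φ_{2p^j}(1) = 1. -/
lemma geom_sum_sq_mem_cyclotomicDenominators (h2 : p ≠ 2) {s n : ℕ} (hn : ¬ p ^ (s + 1) ∣ n)
    (hn0 : n ≠ 0) : ∑ i ∈ Finset.range n, ((X : ℤ[X]) ^ 2) ^ i ∈ cyclotomicDenominators p s := by
  obtain ⟨v, y, hy, rfl⟩ := Nat.exists_eq_pow_mul_and_not_dvd hn0 p hp.out.ne_one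
  have hv : v ≤ s := by
    by_contra h
    exact hn (Dvd.dvd.mul_right (pow_dvd_pow p (by omega)) y)
  have key : ∑ i ∈ Finset.range (p ^ v * y), ((X : ℤ[X]) ^ 2) ^ i =
      (∏ j ∈ Finset.range v, expand ℤ 2 (cyclotomic (p ^ (j + 1)) ℤ)) *
        ∑ i ∈ Finset.range y, (((X : ℤ[X]) ^ 2) ^ p ^ v) ^ i := by
    have h := congrArg (expand ℤ 2) (prod_cyclotomic_mul_X_sub_one (p := p) v)
    simp only [map_mul, map_prod, map_sub, map_one, map_pow, expand_X] at h
    have h0 : (X : ℤ[X]) ^ 2 - 1 ≠ 0 := by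
      simpa using X_pow_sub_C_ne_zero (R := ℤ) (n := 2) (by norm_num) 1
    apply mul_right_cancel₀ h0
    rw [geom_sum_mul, mul_right_comm, h, mul_comm (_ - 1), geom_sum_mul, ← pow_mul (X ^ 2)]
  rw [key]
  refine mul_mem (prod_mem fun j hj => ?_) (mem_cyclotomicDenominators_of_not_dvd ?_)
  · rw [Finset.mem_range] at hj
    have hj2 : ¬ 2 ∣ p ^ (j + 1) := fun h => h2
      ((Nat.prime_dvd_prime_iff_eq Nat.prime_two hp.out).1 (Nat.prime_two.dvd_of_dvd_pow h)).symm
    have e := cyclotomic_expand_eq_cyclotomic_mul Nat.prime_two hj2 ℤ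
    have e1 := congrArg (eval 1) e
    rw [expand_eval, one_pow, eval_mul, eval_one_cyclotomic_prime_pow] at e1
    rw [e]
    refine mul_mem (mem_cyclotomicDenominators_of_not_dvd ?_)
      (cyclotomic_mem_cyclotomicDenominators (by omega))
    have hp0 : (p : ℤ) ≠ 0 := by exact_mod_cast hp.out.ne_zero
    have : eval 1 (cyclotomic (p ^ (j + 1) * 2) ℤ) = 1 := by
      apply mul_right_cancel₀ hp0
      rw [← e1, one_mul]
    rw [this]
    exact (Nat.prime_iff_prime_int.1 hp.out).not_dvd_one
  · simp only [eval_finsetSum, eval_pow, eval_X, one_pow, Finset.sum_const, Finset.card_range,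
      nsmul_eq_mul, mul_one]
    exact_mod_cast hy

/-- Distinct cyclotomic polynomials are coprime over ℚ, and division by a monic integer polynomial
stays in ℤ[X]. -/
lemma prod_cyclotomic_pow_dvd {s : ℕ} (g : ℕ → ℕ) {A : ℤ[X]}
    (h : ∀ j < s, cyclotomic (p ^ (j + 1)) ℚ ^ g j ∣ A.map (Int.castRingHom ℚ)) :
    (∏ j ∈ Finset.range s, cyclotomic (p ^ (j + 1)) ℤ ^ g j) ∣ A := by
  rw [← Polynomial.map_dvd_map (Int.castRingHom ℚ) Int.cast_injective
    (monic_prod_of_monic _ _ fun j _ => (cyclotomic.monic _ ℤ).pow _), Polynomial.map_prod]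
  simp only [Polynomial.map_pow, map_cyclotomic_int]
  refine Finset.prod_dvd_of_coprime (fun i _ j _ hij => ?_) fun j hj => h j (Finset.mem_range.1 hj)
  have hne : p ^ (i + 1) ≠ p ^ (j + 1) := fun h => hij (by
    have := Nat.pow_right_injective hp.out.two_le h
    omega)
  exact (cyclotomic.isCoprime_rat hne).pow

variable {K : Type*} [Field K] [Algebra ℚ[X] K]

/-- `IntRep p s f c` says that `f` is a quotient of integer polynomials with denominator in
`cyclotomicDenominators p s`, with value `c` at `1`. -/
def IntRep (p s : ℕ) [Fact p.Prime] (f : K) (c : ℚ) : Prop :=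
  FracVal ((algebraMap ℚ[X] K).comp (mapRingHom (Int.castRingHom ℚ)))
    ((Int.castRingHom ℚ).comp (evalRingHom 1)) (cyclotomicDenominators p s) f c

/-- `f` vanishes to order at least `e` at the primitive `n`-th roots of unity. -/
def VanishesAt (n : ℕ) (f : K) (e : ℕ) : Prop :=
  ∃ A B : ℚ[X], ¬ cyclotomic n ℚ ∣ B ∧
    f * algebraMap ℚ[X] K B = algebraMap ℚ[X] K (cyclotomic n ℚ ^ e * A)

/-- Φ_n is the minimal polynomial of ζ over ℚ, so a zero at one primitive root forces divisibility
of the numerator by Φ_n. -/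
lemma vanishesAt_of_resAt {n : ℕ} (hn : 0 < n) {ζ : ℂ} (hζ : IsPrimitiveRoot ζ n) {f : K}
    (h : ResAt ζ f 0) : VanishesAt n f 1 := by
  obtain ⟨A, B, hB, h1, h2⟩ := h
  have hB' : aeval ζ B ≠ 0 := nonZeroDivisors.ne_zero hB
  have hA : aeval ζ A = 0 := h2.trans (zero_mul _)
  have hΦ := cyclotomic_eq_minpoly_rat hζ hn
  obtain ⟨A', rfl⟩ : cyclotomic n ℚ ∣ A := hΦ ▸ minpoly.dvd ℚ ζ hA
  refine ⟨A', B, fun hd => hB' ?_, by rw [pow_one, h1]⟩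
  obtain ⟨C, rfl⟩ := hd
  rw [map_mul, hΦ, minpoly.aeval, zero_mul]

variable [IsFractionRing ℚ[X] K]

lemma qNum_indet_succ_mul_pow (n : ℕ) : qNum (indet K) (n + 1) * indet K ^ n =
    ∑ i ∈ Finset.range (n + 1), (indet K ^ 2) ^ i :=
  qNum_succ_mul_pow indet_ne_zero (indet_pow_ne_one (by norm_num)) n

lemma intRep_qNum (s : ℕ) (x : ℤ) : IntRep p s (qNum (indet K) x) x := by
  have key : ∀ n : ℕ, IntRep p s (qNum (indet K) n) n := by
    rintro (_ | n)
    · rw [Nat.cast_zero, qNum_zero, Nat.cast_zero]; exact FracVal.zero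
    · refine ⟨∑ i ∈ Finset.range (n + 1), (X ^ 2) ^ i, X ^ n,
        mem_cyclotomicDenominators_of_not_dvd ?_, ?_, ?_⟩
      · simpa using (Nat.prime_iff_prime_int.1 hp.out).not_dvd_one
      · simpa [indet] using qNum_indet_succ_mul_pow (K := K) n
      · simp
  rcases Int.eq_nat_or_neg x with ⟨m, rfl | rfl⟩
  · exact_mod_cast key m
  · rw [qNum_neg]
    have := FracVal.neg (key m)
    rw [IntRep]
    convert this using 1
    push_cast; rfl

lemma intRep_inv_qNum (h2 : p ≠ 2) {s : ℕ} {x : ℤ} (hx0 : x ≠ 0) (hx : ¬ (p : ℤ) ^ (s + 1) ∣ x) :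
    IntRep p s (qNum (indet K) x)⁻¹ (x : ℚ)⁻¹ := by
  have key : ∀ n : ℕ, n ≠ 0 → ¬ p ^ (s + 1) ∣ n → IntRep p s (qNum (indet K) n)⁻¹ (n : ℚ)⁻¹ := by
    rintro (_ | n) h0 h
    · exact absurd rfl h0
    · refine ⟨X ^ n, ∑ i ∈ Finset.range (n + 1), (X ^ 2) ^ i,
        geom_sum_sq_mem_cyclotomicDenominators h2 h h0, ?_, ?_⟩
      · have hq : qNum (indet K) ((n + 1 : ℕ) : ℤ) ≠ 0 := by
          rw [Ne, qNum_indet_eq_zero_iff]; omega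
        rw [inv_mul_eq_iff_eq_mul₀ hq]
        simpa [indet] using (qNum_indet_succ_mul_pow (K := K) n).symm
      · have : (n + 1 : ℚ) ≠ 0 := by positivity
        simp [this]
  rcases Int.eq_nat_or_neg x with ⟨m, rfl | rfl⟩
  · exact_mod_cast key m (by exact_mod_cast hx0) (by exact_mod_cast hx)
  · rw [qNum_neg, inv_neg]
    have := FracVal.neg (key m (by simpa using hx0) (by
      rw [dvd_neg] at hx; exact_mod_cast hx))
    rw [IntRep]
    convert this using 1
    push_cast; rw [inv_neg]

/-- For odd n > 1, ζ² ≠ 1, so ζ is a zero of the geometric sum representing [n]. Each factor [n]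
therefore adds one Φ_n to the one coming from `G`. -/
lemma vanishesAt_of_resAt_qNum_pow {n : ℕ} (hn : 1 < n) (hodd : Odd n) {ζ : ℂ}
    (hζ : IsPrimitiveRoot ζ n) {G : K} (h : ResAt ζ G 0) (e : ℕ) :
    VanishesAt n (qNum (indet K) n ^ e * G) (e + 1) := by
  obtain ⟨A, B, hB, h1⟩ := vanishesAt_of_resAt (by omega) hζ h
  obtain ⟨m, rfl⟩ : ∃ m, n = m + 1 := ⟨n - 1, by omega⟩
  have hΦ := cyclotomic_eq_minpoly_rat hζ (by omega)
  have hQ : cyclotomic (m + 1) ℚ ∣ ∑ i ∈ Finset.range (m + 1), ((X : ℚ[X]) ^ 2) ^ i := by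
    rw [hΦ]
    apply minpoly.dvd
    simp only [map_sum, map_pow, aeval_X]
    rw [geom_sum_eq (IsPrimitiveRoot.sq_ne_one_of_odd hn hζ hodd), ← pow_mul, mul_comm, pow_mul,
      hζ.pow_eq_one]
    simp
  obtain ⟨Q, hQ⟩ := hQ
  have hq := qNum_indet_succ_mul_pow (K := K) m
  have hq' : qNum (indet K) ((m + 1 : ℕ) : ℤ) * indet K ^ m =
      algebraMap ℚ[X] K (cyclotomic (m + 1) ℚ * Q) := by
    rw [← hQ, Nat.cast_add, Nat.cast_one, hq]
    simp [indet]
  have hirr : Prime (cyclotomic (m + 1) ℚ) := (cyclotomic.irreducible_rat (by omega)).prime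
  refine ⟨Q ^ e * A, (X ^ m) ^ e * B, fun hd => ?_, ?_⟩
  · rcases hirr.dvd_or_dvd hd with hd | hd
    · have hX : cyclotomic (m + 1) ℚ ∣ X := hirr.dvd_of_dvd_pow (hirr.dvd_of_dvd_pow hd)
      obtain ⟨C, hC⟩ := hX
      have := congrArg (aeval ζ) hC
      rw [map_mul, hΦ, minpoly.aeval, zero_mul, aeval_X] at this
      exact hζ.ne_zero (by omega) this
    · exact hB hd
  · have : qNum (indet K) ((m + 1 : ℕ) : ℤ) ^ e * G * algebraMap ℚ[X] K ((X ^ m) ^ e * B) =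
        (qNum (indet K) ((m + 1 : ℕ) : ℤ) * indet K ^ m) ^ e * (G * algebraMap ℚ[X] K B) := by
      simp only [map_mul, map_pow, indet]; ring
    rw [this, hq', h1, ← map_pow, ← map_mul]
    congr 1
    ring

/-- Vanishing at roots of unity of order `p, …, p ^ s` forces divisibility of the value at `1` by
powers of `p`. -/
theorem exists_eq_pow_mul_of_vanishesAt {s : ℕ} {f : K} {c : ℚ} (hf : IntRep p s f c) (e : ℕ → ℕ)
    (he : ∀ j < s, VanishesAt (p ^ (j + 1)) f (e j)) :
    ∃ r ∈ localInt p, c = (p : ℚ) ^ (∑ j ∈ Finset.range s, e j) * r := by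
  obtain ⟨A, _, ⟨d, B, hB, rfl⟩, h1, h2⟩ := hf
  have hprod : (∏ j ∈ Finset.range s, cyclotomic (p ^ (j + 1)) ℤ ^ (d j + e j)) ∣ A := by
    refine prod_cyclotomic_pow_dvd _ fun j hj => ?_
    obtain ⟨A₁, B₁, hB₁, h3⟩ := he j hj
    have hprime : Prime (cyclotomic (p ^ (j + 1)) ℚ) :=
      (cyclotomic.irreducible_rat (pow_pos hp.out.pos _)).prime
    have h4 : A.map (Int.castRingHom ℚ) * B₁ =
        ((∏ j ∈ Finset.range s, cyclotomic (p ^ (j + 1)) ℤ ^ d j) * B).map (Int.castRingHom ℚ) *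
          (cyclotomic (p ^ (j + 1)) ℚ ^ e j * A₁) := by
      apply IsFractionRing.injective ℚ[X] K
      rw [map_mul, map_mul (algebraMap ℚ[X] K), ← h3]
      have h1' : f * algebraMap ℚ[X] K (((∏ j ∈ Finset.range s, cyclotomic (p ^ (j + 1)) ℤ ^ d j) *
        B).map (Int.castRingHom ℚ)) = algebraMap ℚ[X] K (A.map (Int.castRingHom ℚ)) := h1
      rw [← h1']
      ring
    -- The numerator must contain the order of vanishing together with whatever power of Φ is in the
    -- denominator.
    refine hprime.pow_dvd_of_dvd_mul_right _ hB₁ ?_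
    rw [h4, pow_add, Polynomial.map_mul, Polynomial.map_prod]
    refine mul_dvd_mul ?_ (dvd_mul_right _ _)
    refine Dvd.dvd.mul_right (Dvd.dvd.trans ?_
      (Finset.dvd_prod_of_mem _ (Finset.mem_range.2 hj))) _
    rw [Polynomial.map_pow, map_cyclotomic_int]
  obtain ⟨A', rfl⟩ := hprod
  have hev : ∀ g : ℕ → ℕ,
      eval 1 (∏ j ∈ Finset.range s, cyclotomic (p ^ (j + 1)) ℤ ^ g j) =
      (p : ℤ) ^ ∑ j ∈ Finset.range s, g j := by
    intro g
    rw [eval_prod, ← Finset.prod_pow_eq_pow_sum]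
    exact Finset.prod_congr rfl fun j _ => by rw [eval_pow, eval_one_cyclotomic_prime_pow]
  have hB0 : ((B.eval 1 : ℤ) : ℚ) ≠ 0 := by
    rintro h0
    exact hB (by simp [Int.cast_eq_zero.1 h0])
  have hp0 : (p : ℚ) ≠ 0 := by exact_mod_cast hp.out.ne_zero
  simp only [RingHom.comp_apply, coe_evalRingHom, eval_mul, hev, eq_intCast, Int.cast_mul,
    Int.cast_pow, Int.cast_natCast] at h2
  rw [Finset.sum_add_distrib, pow_add] at h2
  refine ⟨(A'.eval 1 : ℤ) / (B.eval 1 : ℤ), ⟨A'.eval 1, B.eval 1, hB, by field_simp⟩, ?_⟩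
  have hpd : (p : ℚ) ^ (∑ j ∈ Finset.range s, d j) ≠ 0 := pow_ne_zero _ hp0
  rw [← mul_div_assoc, eq_div_iff hB0]
  apply mul_left_cancel₀ hpd
  linear_combination -h2

end Integral

/-! ### Divisibility of the second difference -/

lemma intRep_ratioProd {p : ℕ} [hp : Fact p.Prime] {K : Type*} [Field K] [Algebra ℚ[X] K]
    [IsFractionRing ℚ[X] K] (h2 : p ≠ 2) {s : ℕ} {c : ℤ} {k : ℕ}
    (h0 : ∀ i < k, 3 * (i : ℤ) + 3 + c ≠ 0)
    (h : ∀ i < k, ¬ (p : ℤ) ^ (s + 1) ∣ 3 * (i : ℤ) + 3 + c) :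
    IntRep p s (ratioProd (qNum (indet K)) c k) (ratioProd (fun x : ℤ => (x : ℚ)) c k) :=
  FracVal.prod fun i hi => FracVal.mul (intRep_qNum s _)
    (intRep_inv_qNum h2 (h0 i (Finset.mem_range.1 hi)) (h i (Finset.mem_range.1 hi)))

/-- The second difference of the very-well-poised series is divisible by `p ^ (s + 4)`. -/
theorem sum_diffTerm_mem {p : ℕ} [hp : Fact p.Prime] (h5 : 5 ≤ p) {t n m : ℕ}
    (hN : p ^ (t + 1) = 3 * n + 1) (hnm : n ≤ m) (hm : m = n ∨ m = 3 * n) :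
    ∃ r ∈ localInt p, ∑ k ∈ Finset.range (m + 1),
      diffTerm (fun x : ℤ => (x : ℚ)) (3 * n + 1) k = (p : ℚ) ^ (t + 5) * r := by
  have hodd : Odd p := hp.out.odd_of_ne_two (by omega)
  have hpN : p ≤ 3 * n + 1 := hN ▸ Nat.le_self_pow (by omega) p
  have hp3 : Nat.Coprime p 3 := (Nat.coprime_primes hp.out Nat.prime_three).2 (by omega)
  have hmN : m < 3 * n + 1 := by omega
  -- Every denominator 3i+3+c has absolute value below 4N, which is less than pN = p^(t+2) since p ≥
  -- 5. Hence only Φ_p, …, Φ_{p^(t+1)} can occur as bad factors.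
  have hbig : ∀ x : ℤ, x ≠ 0 → |x| < 4 * (3 * n + 1) → ¬ (p : ℤ) ^ (t + 1 + 1) ∣ x := by
    intro x hx0 hx hd
    refine hx0 (Int.eq_zero_of_abs_lt_dvd hd (hx.trans_le ?_))
    have : (p : ℤ) ^ (t + 1) = 3 * n + 1 := by exact_mod_cast hN
    rw [pow_succ, this, mul_comm]
    exact mul_le_mul_of_nonneg_left (by omega) (by omega)
  have hrep : ∀ k ≤ m, ∀ c : ℤ, c = 0 ∨ c = 3 * n + 1 ∨ c = -(3 * n + 1) →
      IntRep p (t + 1) (ratioProd (qNum (indet (RatFunc ℚ))) c k)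
        (ratioProd (fun x : ℤ => (x : ℚ)) c k) := by
    intro k hk c hc
    have h0 : ∀ i < k, 3 * (i : ℤ) + 3 + c ≠ 0 := by intro i _; omega
    refine intRep_ratioProd (by omega) h0 fun i hi => hbig _ (h0 i hi) ?_
    rw [abs_lt]
    constructor <;> omega
  have hf : IntRep p (t + 1) (∑ k ∈ Finset.range (m + 1),
      diffTerm (qNum (indet (RatFunc ℚ))) (3 * n + 1) k)
      (∑ k ∈ Finset.range (m + 1), diffTerm (fun x : ℤ => (x : ℚ)) (3 * n + 1) k) := by
    refine FracVal.sum fun k hk => ?_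
    have hk : k ≤ m := Nat.lt_succ_iff.1 (Finset.mem_range.1 hk)
    exact FracVal.mul (FracVal.mul (intRep_qNum _ _) (FracVal.pow (hrep k hk 0 (by simp)) 2))
      (FracVal.pow (FracVal.sub (FracVal.pow (hrep k hk 0 (by simp)) 2)
        (FracVal.mul (hrep k hk _ (by simp)) (hrep k hk _ (by simp)))) 2)
  -- Order 5 at the top level and 1 at each of the t lower levels: total t + 5.
  obtain ⟨r, hr, e⟩ := exists_eq_pow_mul_of_vanishesAt hf (fun j => if j = t then 5 else 1) (by
    intro j hj
    have hP : 1 < p ^ (j + 1) := Nat.one_lt_pow (by omega) hp.out.one_lt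
    have hPodd : Odd (p ^ (j + 1)) := hodd.pow
    have hζ := Complex.isPrimitiveRoot_exp (p ^ (j + 1)) (by omega)
    split_ifs with hjt
    · subst hjt
      rw [hN] at hP hPodd hζ ⊢
      obtain ⟨G, hG, hr⟩ := exists_sum_diffTerm_eq_pow_mul (K := RatFunc ℚ) (by omega) hζ hPodd
        hnm hmN
      rw [hG]
      exact_mod_cast vanishesAt_of_resAt_qNum_pow hP hPodd hζ hr 4
    · refine vanishesAt_of_resAt (by omega) hζ ?_
      have hd : p ^ (j + 1) ∣ 3 * n + 1 := hN ▸ pow_dvd_pow p (by omega)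
      have h3 : Nat.Coprime (p ^ (j + 1)) 3 := hp3.pow_left _
      generalize p ^ (j + 1) = P at *
      -- Within a block of length P, the centre of reflection is governed by the residue of n.
      have hdn : P ∣ 3 * (n % P) + 1 := by
        have h := Nat.div_add_mod n P
        have : 3 * n + 1 = P * (3 * (n / P)) + (3 * (n % P) + 1) := by
          conv_lhs => rw [← h]
          ring
        rw [this] at hd
        exact (Nat.dvd_add_right (dvd_mul_right _ _)).1 hd
      have hlt : n % P < P := Nat.mod_lt _ (by omega)
      have key := fun a {L : ℕ} (hL : n % P < L) (hLP : L ≤ P) =>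
        resAt_sum_diffTerm (K := RatFunc ℚ) hP hζ hPodd h3 hdn hlt (N := 3 * n + 1)
          (by exact_mod_cast hd) (by omega) a hL hLP
      -- For m = n the last block stops just after its residue n % P, beyond which terms vanish at
      -- ζ. For m = 3n the N terms fill whole blocks.
      rcases hm with rfl | rfl
      · have := key (m / P) (Nat.lt_succ_self _) hlt
        rwa [Nat.succ_eq_add_one, ← add_assoc, Nat.div_add_mod'] at this
      · obtain ⟨q, hq⟩ := hd
        obtain ⟨a, rfl⟩ : ∃ a, q = a + 1 := ⟨q - 1, by
          rcases q with _ | q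
          · omega
          · omega⟩
        have := key a hlt le_rfl
        rwa [show a * P + P = 3 * n + 1 by rw [hq]; ring] at this)
  refine ⟨r, hr, ?_⟩
  rw [e, Finset.sum_range_succ, if_pos rfl, Finset.sum_congr rfl fun j hj =>
    if_neg (Finset.mem_range.1 hj).ne]
  simp

/-! ### Return to the original series -/

lemma pairedRatio_eq_ratioProd (N : ℤ) (k : ℕ) : pairedRatio N k =
    ratioProd (fun x : ℤ => (x : ℚ)) N k * ratioProd (fun x : ℤ => (x : ℚ)) (-N) k := by
  rw [pairedRatio, ratioProd, ratioProd, ← Finset.prod_mul_distrib]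
  refine Finset.prod_congr rfl fun i _ => ?_
  push_cast
  rw [mul_mul_mul_comm, ← mul_inv, ← div_eq_mul_inv]
  congr 1 <;> ring

lemma shiftedFactorial_one_third_div (k : ℕ) :
    shiftedFactorial (1 / 3) k / k.factorial = ratioProd (fun x : ℤ => (x : ℚ)) 0 k := by
  induction k with
  | zero => simp [shiftedFactorial, ratioProd]
  | succ k ih =>
    rw [ratioProd_succ, ← ih, shiftedFactorial, shiftedFactorial, ascPochhammer_succ_eval,
      Nat.factorial_succ]
    push_cast
    have : (k.factorial : ℚ) ≠ 0 := by exact_mod_cast k.factorial_ne_zero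
    field_simp
    ring

lemma shiftedFactorial_two_thirds_div (n : ℕ) :
    shiftedFactorial (2 / 3) n / shiftedFactorial 1 n = twoThirdsRatio n := by
  induction n with
  | zero => simp [shiftedFactorial, twoThirdsRatio]
  | succ n ih =>
    rw [twoThirdsRatio_succ, ← ih, shiftedFactorial, shiftedFactorial, ascPochhammer_succ_eval,
      shiftedFactorial, shiftedFactorial, ascPochhammer_succ_eval, mul_div_mul_comm]
    congr 1
    field_simp
    ring

/-- Second-order expansion of the series about its summable specializations. -/
lemma sum_eq_add_sum_diffTerm {n m : ℕ} (hnm : n ≤ m) :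
    ∑ k ∈ Finset.range (m + 1),
        (6 * (k : ℚ) + 1) * (shiftedFactorial (1 / 3) k ^ 6 / (k.factorial : ℚ) ^ 6) =
      (3 * n + 1) * twoThirdsRatio n * (2 * twoThirdsRatio n ^ 2 - pairedValue (3 * n + 1) n) +
        ∑ k ∈ Finset.range (m + 1), diffTerm (fun x : ℤ => (x : ℚ)) (3 * n + 1) k := by
  have hx : ∀ i : ℕ, (3 * (i : ℚ) + 3) ^ 2 - (3 * (n : ℚ) + 1) ^ 2 ≠ 0 := by
    intro i
    have a : (3 * (i : ℚ) + 3 + (3 * n + 1)) ≠ 0 := by positivity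
    have b : (3 * (i : ℚ) + 3 - (3 * n + 1)) ≠ 0 := by
      convert three_mul_add_ne_zero (i - n) (c := 2) (by norm_num) using 1; push_cast; ring
    convert mul_ne_zero a b using 1; ring
  have h0 := sum_wellPoised 0 (fun i => by
    rw [zero_pow two_ne_zero, sub_zero]; positivity) n
  have h1 := sum_wellPoised (3 * (n : ℚ) + 1) hx n
  have hv : pairedValue 0 n = twoThirdsRatio n ^ 2 := by
    rw [pairedValue, twoThirdsRatio, ← Finset.prod_pow]
    exact Finset.prod_congr rfl fun i _ => by rw [div_pow]; simp
  have ext : ∀ f : ℕ → ℚ, (∀ k, n < k → f k = 0) →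
      ∑ k ∈ Finset.range (m + 1), f k = ∑ k ∈ Finset.range (n + 1), f k := by
    intro f hf
    symm
    refine Finset.sum_subset (Finset.range_mono (by omega)) fun k _ hk => hf k ?_
    rw [Finset.mem_range] at hk
    omega
  -- The closed forms stop at k = n, but the products at parameter N vanish for k > n, so the sums
  -- may be extended to m.
  rw [← ext _ fun k hk => by rw [pairedRatio_eq_zero hk, mul_zero]] at h0 h1
  rw [hv] at h0
  have e : (3 * (n : ℚ) + 1) * twoThirdsRatio n *
      (2 * twoThirdsRatio n ^ 2 - pairedValue (3 * n + 1) n) =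
      2 * ((3 * (n : ℚ) + 1) * twoThirdsRatio n * twoThirdsRatio n ^ 2) -
        (3 * (n : ℚ) + 1) * twoThirdsRatio n * pairedValue (3 * n + 1) n := by ring
  -- Termwise this is U^6 = 2U^4 V - U² V² + U²(U² - V)², with V the paired product at N.
  rw [e, ← h0, ← h1, Finset.mul_sum, ← Finset.sum_sub_distrib, ← Finset.sum_add_distrib]
  refine Finset.sum_congr rfl fun k _ => ?_
  have u0 := pairedRatio_eq_ratioProd 0 k
  have u1 := pairedRatio_eq_ratioProd (3 * n + 1) k
  push_cast at u0 u1
  rw [neg_zero] at u0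
  rw [diffTerm, ← div_pow, shiftedFactorial_one_third_div, ← u1, u0]
  push_cast
  ring

lemma sum_Icc_eq_sum_range (n : ℕ) :
    ∑ j ∈ Finset.Icc 1 n, (1 / (3 * (j : ℚ) - 1) ^ 2 - 1 / (3 * (j : ℚ)) ^ 2) =
    ∑ i ∈ Finset.range n, (1 / (3 * (i : ℚ) + 2) ^ 2 - 1 / (3 * (i : ℚ) + 3) ^ 2) := by
  induction n with
  | zero => simp
  | succ n ih =>
    rw [Finset.sum_Icc_succ_top (by omega), ih, Finset.sum_range_succ]
    push_cast
    ring_nf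

theorem corollary1p5 (p s m : ℕ) (hp : p.Prime) (hodd : Odd p) (hs : 1 ≤ s)
    (hps : p ^ s ≡ 1 [MOD 3]) (hm : m = (p ^ s - 1) / 3 ∨ m = p ^ s - 1) :
    RatModEqPrimePow p (s + 4)
      (∑ k ∈ Finset.range (m + 1),
        (6 * (k : ℚ) + 1) * (shiftedFactorial (1 / 3) k ^ 6 / (k.factorial : ℚ) ^ 6))
      (shiftedFactorial (2 / 3) ((p ^ s - 1) / 3) ^ 3 / shiftedFactorial 1 ((p ^ s - 1) / 3) ^ 3 *
        ((p : ℚ) ^ s + (p : ℚ) ^ (3 * s) *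
          ∑ j ∈ Finset.Icc 1 ((p ^ s - 1) / 3),
            (1 / (3 * (j : ℚ) - 1) ^ 2 - 1 / (3 * (j : ℚ)) ^ 2))) := by
  have : Fact p.Prime := ⟨hp⟩
  obtain ⟨t, rfl⟩ : ∃ t, s = t + 1 := ⟨s - 1, by omega⟩
  obtain ⟨n, hn⟩ : ∃ n, p ^ (t + 1) = 3 * n + 1 := ⟨p ^ (t + 1) / 3, by
    have : p ^ (t + 1) % 3 = 1 := hps
    omega⟩
  have hp3 : p ≠ 3 := by
    rintro rfl
    rw [pow_succ] at hn
    omega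
  have h5 : 5 ≤ p := by
    have := hp.two_le
    have h2 : p ≠ 2 := by rintro rfl; exact absurd hodd (by decide)
    have h4 : p ≠ 4 := by rintro rfl; exact absurd hodd (by decide)
    omega
  have hn' : (p ^ (t + 1) - 1) / 3 = n := by omega
  have hNq : (p : ℚ) ^ (t + 1) = 3 * n + 1 := by exact_mod_cast hn
  have hlt : ∀ x : ℕ, 0 < x → x < 3 * n + 1 → (p : ℚ) ^ t / x ∈ localInt p := fun x h0 h =>
    pow_pred_div_mem_localInt (s := t + 1) h0 (hn ▸ h)
  rw [hn'] at hm ⊢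
  -- Here z = p^t, so pz = N. The required integrality holds because the numbers 3i+2 and 3i+3 are
  -- all below N = p^(t+1).
  obtain ⟨r, hr, er⟩ := pairedValue_expansion (p := p) ((p : ℚ) ^ t) n
    (fun i hi => by exact_mod_cast hlt (3 * i + 2) (by omega) (by omega))
    (fun i hi => by exact_mod_cast hlt (3 * i + 3) (by omega) (by omega))
  rw [← pow_succ', hNq] at er
  obtain ⟨w, hw, ew⟩ := sum_diffTerm_mem h5 hn (m := m) (by omega) (by omega)
  refine ⟨w - twoThirdsRatio n ^ 3 * r, not_dvd_den_of_mem_localInt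
    (sub_mem hw (mul_mem (pow_mem (twoThirdsRatio_mem_localInt hp3 n) 3) hr)), ?_⟩
  rw [sum_eq_add_sum_diffTerm (n := n) (by omega), ew, er, ← div_pow,
    shiftedFactorial_two_thirds_div, sum_Icc_eq_sum_range, mul_comm 3 (t + 1), pow_mul, hNq,
    show t + 1 + 4 = (t + 1) + 4 by ring, show t + 5 = (t + 1) + 4 by ring, pow_add, hNq]
  ring
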